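/- Let $\mathbb{K}$ be a field and let $K_0(\mathcal{V}_{\mathbb{K}})$ be the Grothendieck ring of varieties over $\mathbb{K}$: the abelian group generated by isomorphism classes $[X]$ of varieties modulo $[X]=[Y]+[X\smallsetminus Y]$ for closed $Y\subseteq X$, with product $[X]\cdot[Y]=[X\times Y]$. Put $\mathbb{T}=[\mathbb{A}^1\smallsetminus\mathbb{A}^0]$. For a graph $G$ with finitely many edges (loops and multiple edges are allowed), let $\Psi_G(t)=\sum_{T}\prod_{e\notin E(T)}t_e$ be its Kirchhoff--Symanzik polynomial, in variables $t_e$ indexed by the $n$ edges of $G$, where $T$ runs over the spanning trees of $G$ (if $G$ is not connected, over the unions of one spanning tree for each component), and let $\mathbb{U}(G)=[\mathbb{A}^n\smallsetminus\{\Psi_G=0\}]\in K_0(\mathcal{V}_{\mathbb{K}})$. Let $\Gamma^v$ be a graph with a distinguished edge $e$, with ends $a$ and $b$ (possibly $a=b$), and assume that $e$ is not a bridge. Let $\Gamma$ be the graph obtained by cutting $e$: remove $e$ and attach at $a$ and at $b$ one edge each, leading to two new vertices of valence $1$. Let $\overline\Gamma$ be the graph obtained by inserting a new edge crossing $e$: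 remove $e$, add new vertices $p,q,p',q'$, and add an edge from $a$ to $p$, an edge from $b$ to $q$, two parallel edges between $p$ and $q$, an edge from $p$ to $p'$, and an edge from $q$ to $q'$. Then \[ \mathbb{T}(\mathbb{T}+1)^4\,\mathbb{U}(\Gamma^v)=\mathbb{U}(\overline\Gamma)-\mathbb{T}(\mathbb{T}+1)^2\,\mathbb{U}(\Gamma) \] in $K_0(\mathcal{V}_{\mathbb{K}})$; in particular \[ \mathbb{U}(\Gamma^v)=\frac{\mathbb{U}(\overline\Gamma)-\mathbb{T}(\mathbb{T}+1)^2\,\mathbb{U}(\Gamma)}{\mathbb{T}(\mathbb{T}+1)^4} \] in the localization of $K_0(\mathcal{V}_{\mathbb{K}})$ at the powers of $\mathbb{T}(\mathbb{T}+1)^4$. -/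

import Mathlib

open CategoryTheory CategoryTheory.Limits AlgebraicGeometry

universe u v

/-! ## The Grothendieck ring of varieties -/

/-- A variety over a field `K`: a separated scheme of finite type over `Spec K`.
(Reducedness is not imposed; it makes no difference to the Grothendieck ring, because
`X_red ⟶ X` is a closed immersion with empty complement.) -/
structure KVariety (K : Type u) [Field K] where
  toOver : Over (Spec (CommRingCat.of K))
  locallyOfFiniteType : LocallyOfFiniteType toOver.hom
  quasiCompact : QuasiCompact toOver.hom
  isSeparated : IsSeparated toOver.hom

attribute [instance] KVariety.locallyOfFiniteType KVariety.quasiCompact KVariety.isSeparated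

namespace KVariety

variable {K : Type u} [Field K]

/-- The variety `Spec K`, a point. -/
noncomputable def point (K : Type u) [Field K] : KVariety K where
  toOver := Over.mk (𝟙 (Spec (CommRingCat.of K)))
  locallyOfFiniteType := by dsimp; infer_instance
  quasiCompact := by dsimp; infer_instance
  isSeparated := by dsimp; infer_instance

/-- The product `X ×_K Y` of two varieties. -/
noncomputable def prod (X Y : KVariety K) : KVariety K where
  toOver := Over.mk (pullback.fst X.toOver.hom Y.toOver.hom ≫ X.toOver.hom)
  locallyOfFiniteType := by dsimp; infer_instance
  quasiCompact := by dsimp; infer_instance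
  isSeparated := by dsimp; infer_instance

/-- `Y` is (isomorphic to) a closed subvariety of `X` and `U` is (isomorphic to) its open
complement `X ∖ Y`. -/
def IsClosedOpenDecomposition (X Y U : KVariety K) : Prop :=
  ∃ (i : Y.toOver ⟶ X.toOver) (j : U.toOver ⟶ X.toOver),
    IsClosedImmersion i.left ∧ IsOpenImmersion j.left ∧
      Set.range j.left = (Set.range i.left)ᶜ

/-- The affine space `𝔸^ι = Spec K[t_i : i ∈ ι]`. -/
noncomputable abbrev affineSpace (K ι : Type u) [Field K] : Scheme.{u} :=
  Spec (CommRingCat.of (MvPolynomial ι K))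

/-- The structure morphism `𝔸^ι ⟶ Spec K`. -/
noncomputable abbrev affineSpaceMap (K ι : Type u) [Field K] :
    affineSpace K ι ⟶ Spec (CommRingCat.of K) :=
  Spec.map (CommRingCat.ofHom (MvPolynomial.C : K →+* MvPolynomial ι K))

/-- The open subset `{f ≠ 0}` of affine space. -/
noncomputable def nonvanishingLocus {ι : Type u} (f : MvPolynomial ι K) :
    (affineSpace K ι).Opens :=
  PrimeSpectrum.basicOpen f

/-- The complement `𝔸^ι ∖ {f = 0}` of the hypersurface `f = 0` in affine space. -/
noncomputable def hypersurfaceComplement {ι : Type u} [Finite ι] (f : MvPolynomial ι K) :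
    KVariety K where
  toOver := Over.mk ((nonvanishingLocus f).ι ≫ affineSpaceMap K ι)
  locallyOfFiniteType := by
    have : LocallyOfFiniteType (affineSpaceMap K ι) := by
      rw [HasRingHomProperty.Spec_iff (P := @LocallyOfFiniteType)]
      exact RingHom.finiteType_algebraMap.mpr (inferInstance : Algebra.FiniteType K (MvPolynomial ι K))
    dsimp; infer_instance
  quasiCompact := by
    have : IsNoetherianRing (CommRingCat.of (MvPolynomial ι K)) :=
      inferInstanceAs (IsNoetherianRing (MvPolynomial ι K))
    dsimp; infer_instance
  isSeparated := by dsimp; infer_instance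

end KVariety

/-- The relations of the Grothendieck ring of varieties: isomorphic varieties have the same class,
`[X] = [Y] + [X ∖ Y]` for closed subvarieties `Y ⊆ X`, `[X] · [Y] = [X × Y]`, and `[Spec K] = 1`. -/
inductive GrothendieckRelation (K : Type u) [Field K] : FreeCommRing (KVariety K) → Prop
  | iso (X Y : KVariety K) (h : Nonempty (X.toOver ≅ Y.toOver)) :
      GrothendieckRelation K (FreeCommRing.of X - FreeCommRing.of Y)
  | scissors (X Y U : KVariety K) (h : X.IsClosedOpenDecomposition Y U) :
      GrothendieckRelation K (FreeCommRing.of X - (FreeCommRing.of Y + FreeCommRing.of U))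
  | mul (X Y : KVariety K) :
      GrothendieckRelation K (FreeCommRing.of (X.prod Y) - FreeCommRing.of X * FreeCommRing.of Y)
  | one : GrothendieckRelation K (FreeCommRing.of (KVariety.point K) - 1)

/-- The Grothendieck ring `K₀(𝒱_K)` of varieties over `K`, presented as a commutative ring by the
classes of varieties and the relations above. (The product relations identify the free commutative
ring with the free abelian group on isomorphism classes, on which the scissors relations already
span an ideal; so this is the usual free abelian group modulo the scissors relations,
with `[X] · [Y] = [X × Y]`.) -/
abbrev GrothendieckRing (K : Type u) [Field K] : Type (u + 1) :=
  FreeCommRing (KVariety K) ⧸ Ideal.span {r | GrothendieckRelation K r}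

/-- The class `[X]` of a variety in the Grothendieck ring. -/
noncomputable def KVariety.motivicClass {K : Type u} [Field K] (X : KVariety K) :
    GrothendieckRing K :=
  Ideal.Quotient.mk _ (FreeCommRing.of X)

/-- The class `𝕋 = [𝔸¹ ∖ 𝔸⁰]` of the torus: the complement of the origin in the affine line. -/
noncomputable def torusClass (K : Type u) [Field K] : GrothendieckRing K :=
  (KVariety.hypersurfaceComplement (K := K) (MvPolynomial.X PUnit.unit)).motivicClass

/-! ## Graphs and their Grothendieck classes -/

namespace Graph

variable {α : Type v} {β : Type u}

/-- Two vertices are joined by a (possibly empty) path of edges. -/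
def Joined (G : Graph α β) (x y : α) : Prop := Relation.ReflTransGen G.Adj x y

/-- An edge is a bridge if its two ends are no longer joined once the edge is deleted. -/
def IsBridgeEdge (G : Graph α β) (e : β) : Prop :=
  ∃ x y, G.IsLink e x y ∧ ¬ (G.deleteEdges {e}).Joined x y

/-- A set of edges forms a spanning tree of `G` (a spanning tree of each component, in case
`G` is not connected): the spanning subgraph `G.restrict F` has no cycles, i.e. each of its edges
is a bridge, and it joins the same pairs of vertices as `G`. -/
def IsSpanningForest (G : Graph α β) (F : Set β) : Prop :=
  F ⊆ E(G) ∧ (∀ e ∈ F, (G.restrict F).IsBridgeEdge e) ∧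
    ∀ x y, G.Joined x y → (G.restrict F).Joined x y

open scoped Classical in
/-- The Kirchhoff–Symanzik polynomial `Ψ_G(t) = ∑_T ∏_{e ∉ E(T)} t_e`, in variables indexed by the
edges of `G`, the sum running over the spanning trees `T` of `G`. -/
noncomputable def kirchhoffPolynomial (K : Type u) [Field K] (G : Graph α β) [Finite E(G)] :
    MvPolynomial E(G) K :=
  letI := Fintype.ofFinite E(G)
  ∑ F ∈ Finset.univ.filter
      (fun F : Finset E(G) => G.IsSpanningForest (Subtype.val '' (F : Set E(G)))),
    ∏ e ∈ Fᶜ, MvPolynomial.X e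

/-- The Grothendieck class `𝕌(G) = [𝔸ⁿ ∖ X̂_G]` of a graph with `n` edges, where `X̂_G` is
the affine hypersurface `Ψ_G = 0`. -/
noncomputable def grothendieckClass (K : Type u) [Field K] (G : Graph α β) [Finite E(G)] :
    GrothendieckRing K :=
  (KVariety.hypersurfaceComplement (G.kirchhoffPolynomial K)).motivicClass

/-- Delete the edge `e₀` of `G`, add a set `W` of new vertices and a set `ι` of new edges, where the
new edge `i` has the unordered pair of ends `ends i`. -/
def replaceEdge (G : Graph α β) (e₀ : β) {W : Type v} {ι : Type u} (ends : ι → Sym2 (α ⊕ W))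
    (hends : ∀ i x, Sum.inl x ∈ ends i → x ∈ V(G)) : Graph (α ⊕ W) (β ⊕ ι) where
  vertexSet := Sum.inl '' V(G) ∪ Set.range Sum.inr
  edgeSet := Sum.inl '' (E(G) \ {e₀}) ∪ Set.range Sum.inr
  IsLink f p q :=
    (∃ e x y, f = Sum.inl e ∧ p = Sum.inl x ∧ q = Sum.inl y ∧ e ≠ e₀ ∧ G.IsLink e x y) ∨
      ∃ i, f = Sum.inr i ∧ ends i = s(p, q)
  isLink_symm := by
    refine fun f _ => ⟨fun p q h => ?_⟩
    rcases h with ⟨e, x, y, rfl, rfl, rfl, hne, h⟩ | ⟨i, rfl, h⟩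
    · exact Or.inl ⟨e, y, x, rfl, rfl, rfl, hne, h.symm⟩
    · exact Or.inr ⟨i, rfl, h.trans Sym2.eq_swap⟩
  eq_or_eq_of_isLink_of_isLink := by
    intro f p q p' q' h h'
    rcases h with ⟨e, x, y, rfl, rfl, rfl, hne, h⟩ | ⟨i, rfl, h⟩
    · rcases h' with ⟨e', x', y', he, rfl, rfl, hne', h'⟩ | ⟨i, he, h'⟩
      · cases he
        rcases h.left_eq_or_eq h' with rfl | rfl <;> simp
      · simp at he
    · rcases h' with ⟨e', x', y', he, rfl, rfl, hne', h'⟩ | ⟨i', he, h'⟩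
      · simp at he
      · cases he
        have := h.symm.trans h'
        simp only [Sym2.eq_iff] at this
        tauto
  edge_mem_iff_exists_isLink := by
    intro f
    constructor
    · rintro (⟨e, ⟨he, hne⟩, rfl⟩ | ⟨i, rfl⟩)
      · obtain ⟨x, y, h⟩ := G.exists_isLink_of_mem_edgeSet he
        exact ⟨_, _, Or.inl ⟨e, x, y, rfl, rfl, rfl, hne, h⟩⟩
      · induction h : ends i with
        | _ p q => exact ⟨p, q, Or.inr ⟨i, rfl, h⟩⟩
    · rintro ⟨p, q, ⟨e, x, y, rfl, rfl, rfl, hne, h⟩ | ⟨i, rfl, h⟩⟩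
      · exact Or.inl ⟨e, ⟨h.edge_mem, hne⟩, rfl⟩
      · exact Or.inr ⟨i, rfl⟩
  left_mem_of_isLink := by
    rintro f p q (⟨e, x, y, rfl, rfl, rfl, hne, h⟩ | ⟨i, rfl, h⟩)
    · exact Or.inl ⟨x, h.left_mem, rfl⟩
    · rcases p with x | w
      · exact Or.inl ⟨x, hends i x (by rw [h]; simp), rfl⟩
      · exact Or.inr ⟨w, rfl⟩

instance (G : Graph α β) [Finite E(G)] (e₀ : β) {W : Type v} {ι : Type u} [Finite ι]
    (ends : ι → Sym2 (α ⊕ W)) (hends : ∀ i x, Sum.inl x ∈ ends i → x ∈ V(G)) :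
    Finite E(G.replaceEdge e₀ ends hends) :=
  inferInstanceAs (Finite ↑(Sum.inl '' (E(G) \ {e₀}) ∪ Set.range (Sum.inr : ι → β ⊕ ι)))

/-- The two ends left by cutting an edge. -/
inductive CutIndex : Type u
  | left
  | right

/-- The four new vertices of the graph with a crossing edge: `p`, `q` lie on the given edge,
and `p'`, `q'` are the outer ends of the crossing edge. -/
inductive CrossingVertex : Type u
  | p
  | q
  | p'
  | q'

/-- The six new edges of the graph with a crossing edge. -/
inductive CrossingEdge : Type u
  | ap
  | bq
  | pq₁
  | pq₂
  | pp'
  | qq'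

instance : Finite CutIndex.{u} :=
  Finite.of_surjective (fun b : Bool => if b then CutIndex.left else CutIndex.right)
    (by rintro (_ | _); exacts [⟨true, rfl⟩, ⟨false, rfl⟩])

instance : Finite CrossingEdge.{u} :=
  Finite.of_surjective (fun i : Fin 6 => (![.ap, .bq, .pq₁, .pq₂, .pp', .qq'] i : CrossingEdge.{u}))
    (by
      rintro (_ | _ | _ | _ | _ | _)
      exacts [⟨0, rfl⟩, ⟨1, rfl⟩, ⟨2, rfl⟩, ⟨3, rfl⟩, ⟨4, rfl⟩, ⟨5, rfl⟩])

/-- The graph `Γ` obtained from `G` by cutting the edge `e` with ends `a`, `b`: the edge is replaced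
by two edges attached at `a` and at `b`, each leading to a new vertex of valence one. -/
def cutEdge (G : Graph α β) {e : β} {a b : α} (h : G.IsLink e a b) :
    Graph (α ⊕ CutIndex.{v}) (β ⊕ CutIndex.{u}) :=
  G.replaceEdge e (W := CutIndex.{v})
    (fun
      | CutIndex.left => s(Sum.inl a, Sum.inr CutIndex.left)
      | CutIndex.right => s(Sum.inl b, Sum.inr CutIndex.right))
    (by
      rintro (_ | _) x hx <;> simp at hx <;> subst hx
      exacts [h.left_mem, h.right_mem])

/-- The graph `Γ̄` obtained from `G` by inserting a new edge crossing the edge `e` with ends `a`,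
`b`: the edge `e` and the new edge (with outer ends `p'`, `q'` of valence one) meet in two vertices
`p`, `q`, so that both the path `a - p - q - b` subdividing `e` and the path `p' - p - q - q'`
subdividing the new edge are present, with two parallel edges between `p` and `q`. -/
def crossEdge (G : Graph α β) {e : β} {a b : α} (h : G.IsLink e a b) :
    Graph (α ⊕ CrossingVertex.{v}) (β ⊕ CrossingEdge.{u}) :=
  G.replaceEdge e (W := CrossingVertex.{v})
    (fun
      | CrossingEdge.ap => s(Sum.inl a, Sum.inr CrossingVertex.p)
      | CrossingEdge.bq => s(Sum.inl b, Sum.inr CrossingVertex.q)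
      | CrossingEdge.pq₁ => s(Sum.inr CrossingVertex.p, Sum.inr CrossingVertex.q)
      | CrossingEdge.pq₂ => s(Sum.inr CrossingVertex.p, Sum.inr CrossingVertex.q)
      | CrossingEdge.pp' => s(Sum.inr CrossingVertex.p, Sum.inr CrossingVertex.p')
      | CrossingEdge.qq' => s(Sum.inr CrossingVertex.q, Sum.inr CrossingVertex.q'))
    (by
      rintro (_ | _ | _ | _ | _ | _) x hx <;> simp at hx <;> subst hx
      exacts [h.left_mem, h.right_mem])

instance (G : Graph α β) [Finite E(G)] {e : β} {a b : α} (h : G.IsLink e a b) :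
    Finite E(G.cutEdge h) := by
  unfold cutEdge; infer_instance

instance (G : Graph α β) [Finite E(G)] {e : β} {a b : α} (h : G.IsLink e a b) :
    Finite E(G.crossEdge h) := by
  unfold crossEdge; infer_instance

end Graph

/-! Write 𝕃 = 𝕋 + 1 for the class of the affine line. Sorting the forests of Γᵛ by whether they
contain e gives Ψ = t_e F + H, with F the `deletionPolynomial` and H the `contractionPolynomial`;
let [F] be the class of the locus F ≠ 0. Since e is not a bridge, replacing e by a two-terminal
gadget turns Ψ into cF + dH, where c sums over the gadget's forests with two components separating
the terminals and d over its spanning trees (`IsGadget.aeval_kirchhoffPolynomial`).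

For the cut edge c = 1 and d = 0, so 𝕌(Γ) = 𝕃²[F]. For the crossing, let x, y be the variables of
ap, bq and t, t' those of the parallel edges. Then c = tt' + (x + y)(t + t') and d = t + t'. With s
= t + t' and u = x + y + t the polynomial becomes s(uF + H) - t²F; the variable y and those of the
two pendant edges do not occur and contribute 𝕃³.

The class of s(uF + H) - t²F ≠ 0 is computed in `locClass_crossing`. On s = 0 there remains -t²F
with u free, giving 𝕃𝕋[F]. On s ≠ 0 the translation u ↦ u + t²/s leaves s(uF + H) with t free,
giving 𝕃𝕋 𝕌(Γᵛ). Hence 𝕌(Γ̄) = 𝕋𝕃⁴(𝕌(Γᵛ) + [F]), and the formula for 𝕌(Γ) eliminates [F].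

The combinatorics is done by linear algebra over `ZMod 2`: two vertices are joined by a set of edges
exactly when every potential for these edges agrees on them (`joined_restrict_iff`). Forests become
bases in a set of linear forms, and the forests of the crossing gadget are found by a finite check.
-/

/-! ## Classes of affine varieties -/

section AffineClass

open Polynomial

variable (K : Type u) [Field K]

/-- The affine variety `Spec A` of a finitely generated `K`-algebra `A`. -/
noncomputable def KVariety.spec (A : Type u) [CommRing A] [Algebra K A]
    [Algebra.FiniteType K A] : KVariety K where
  toOver := Over.mk (Spec.map (CommRingCat.ofHom (algebraMap K A)))
  locallyOfFiniteType := by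
    dsimp
    rw [HasRingHomProperty.Spec_iff (P := @LocallyOfFiniteType)]
    exact RingHom.finiteType_algebraMap.mpr inferInstance
  quasiCompact := by dsimp; infer_instance
  isSeparated := by dsimp; infer_instance

/-- The class of the affine variety `Spec A`. -/
noncomputable def specClass (A : Type u) [CommRing A] [Algebra K A]
    [Algebra.FiniteType K A] : GrothendieckRing K :=
  (KVariety.spec K A).motivicClass

/-- The class of the open subvariety `f ≠ 0` of `Spec A`. -/
noncomputable def locClass {A : Type u} [CommRing A] [Algebra K A]
    [Algebra.FiniteType K A] (f : A) : GrothendieckRing K :=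
  specClass K (Localization.Away f)

variable {K}

theorem KVariety.motivicClass_eq_of_iso {X Y : KVariety K} (h : X.toOver ≅ Y.toOver) :
    X.motivicClass = Y.motivicClass :=
  Ideal.Quotient.eq.mpr (Ideal.subset_span (GrothendieckRelation.iso X Y ⟨h⟩))

theorem KVariety.motivicClass_eq_add {X Y U : KVariety K}
    (h : X.IsClosedOpenDecomposition Y U) :
    X.motivicClass = Y.motivicClass + U.motivicClass :=
  Ideal.Quotient.eq.mpr (Ideal.subset_span (GrothendieckRelation.scissors X Y U h))

theorem KVariety.motivicClass_prod (X Y : KVariety K) :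
    (X.prod Y).motivicClass = X.motivicClass * Y.motivicClass :=
  Ideal.Quotient.eq.mpr (Ideal.subset_span (GrothendieckRelation.mul X Y))

theorem KVariety.motivicClass_point : (KVariety.point K).motivicClass = 1 :=
  Ideal.Quotient.eq.mpr (Ideal.subset_span GrothendieckRelation.one)

variable {A B C' : Type u} [CommRing A] [Algebra K A] [Algebra.FiniteType K A]
  [CommRing B] [Algebra K B] [Algebra.FiniteType K B]
  [CommRing C'] [Algebra K C'] [Algebra.FiniteType K C']

theorem specClass_congr (φ : A ≃ₐ[K] B) : specClass K A = specClass K B := by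
  refine KVariety.motivicClass_eq_of_iso (Over.isoMk
    (Scheme.Spec.mapIso φ.symm.toRingEquiv.toCommRingCatIso.op) ?_)
  change Spec.map _ ≫ Spec.map _ = Spec.map _
  rw [← Spec.map_comp]
  congr 1
  ext x
  exact φ.symm.commutes x

theorem specClass_self : specClass K K = 1 := by
  rw [← KVariety.motivicClass_point]
  have h : 𝟙 (Spec (CommRingCat.of K)) = Spec.map (CommRingCat.ofHom (algebraMap K K)) := by
    rw [Algebra.algebraMap_self, CommRingCat.ofHom_id, Spec.map_id]
  refine KVariety.motivicClass_eq_of_iso (Over.isoMk (Iso.refl (Spec (CommRingCat.of K))) ?_)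
  refine (Category.id_comp (𝟙 (Spec (CommRingCat.of K)))).trans h

open scoped TensorProduct in
theorem specClass_tensorProduct [Algebra.FiniteType K (A ⊗[K] B)] :
    specClass K (A ⊗[K] B) = specClass K A * specClass K B := by
  rw [specClass, specClass, specClass, ← KVariety.motivicClass_prod]
  refine KVariety.motivicClass_eq_of_iso (Over.isoMk (pullbackSpecIso K A B).symm ?_)
  have h : (pullbackSpecIso K A B).inv ≫
      (pullback.fst (Spec.map (CommRingCat.ofHom (algebraMap K A)))
        (Spec.map (CommRingCat.ofHom (algebraMap K B))) ≫
        Spec.map (CommRingCat.ofHom (algebraMap K A))) =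
      Spec.map (CommRingCat.ofHom (algebraMap K (A ⊗[K] B))) := by
    rw [← Category.assoc, pullbackSpecIso_inv_fst, ← Spec.map_comp, ← CommRingCat.ofHom_comp,
      Algebra.TensorProduct.algebraMap_def]
  exact h

theorem specClass_polynomial : specClass K A[X] = specClass K A * specClass K K[X] := by
  have : Algebra.FiniteType K (TensorProduct K A K[X]) :=
    .equiv inferInstance (polyEquivTensor K A)
  rw [← specClass_tensorProduct]
  exact specClass_congr (polyEquivTensor K A)

/-- Scissors relation for a principal closed subscheme and its complement. -/
theorem specClass_eq_add {u : A} (π : A →ₐ[K] B) (hπ : Function.Surjective π)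
    (hker : RingHom.ker π = Ideal.span {u}) [Algebra A C'] [IsScalarTower K A C']
    [IsLocalization.Away u C'] : specClass K A = specClass K B + specClass K C' := by
  refine KVariety.motivicClass_eq_add
    ⟨Over.homMk (Spec.map (CommRingCat.ofHom π.toRingHom)) ?_,
      Over.homMk (Spec.map (CommRingCat.ofHom (algebraMap A C'))) ?_, ?_, ?_, ?_⟩
  · change Spec.map _ ≫ Spec.map _ = Spec.map _
    rw [← Spec.map_comp, ← CommRingCat.ofHom_comp]
    congr 2
    exact π.comp_algebraMap
  · change Spec.map _ ≫ Spec.map _ = Spec.map _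
    rw [← Spec.map_comp, ← CommRingCat.ofHom_comp, ← IsScalarTower.algebraMap_eq]
  · exact IsClosedImmersion.spec_of_surjective _ hπ
  · exact IsOpenImmersion.of_isLocalization u
  -- The open piece is the basic open set of u, and the closed piece is the zero locus of ker π =
  -- (u).
  · refine (PrimeSpectrum.localization_away_comap_range C' u).trans ?_
    have h := range_comap_of_surjective B π.toRingHom hπ
    refine Eq.trans ?_ (congrArg compl h.symm)
    change _ = (PrimeSpectrum.zeroLocus (RingHom.ker π : Set A))ᶜ
    rw [hker, PrimeSpectrum.zeroLocus_span, PrimeSpectrum.basicOpen_eq_zeroLocus_compl]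

theorem locClass_eq_specClass (f : A) [Algebra A B] [IsScalarTower K A B]
    [IsLocalization.Away f B] : locClass K f = specClass K B :=
  specClass_congr
    ((IsLocalization.algEquiv (Submonoid.powers f) (Localization.Away f) B).restrictScalars K)

/-- A basic open subset of an affine scheme is affine, so all later geometry takes place in
localizations of rings. -/
theorem KVariety.motivicClass_hypersurfaceComplement {ι : Type u} [Finite ι]
    (f : MvPolynomial ι K) :
    (KVariety.hypersurfaceComplement f).motivicClass = locClass K f := by
  refine KVariety.motivicClass_eq_of_iso (Over.isoMk
    (basicOpenIsoSpecAway (R := CommRingCat.of (MvPolynomial ι K)) f) ?_)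
  change _ ≫ Spec.map (CommRingCat.ofHom (algebraMap K (Localization.Away f))) =
    (KVariety.nonvanishingLocus f).ι ≫
      Spec.map (CommRingCat.ofHom (algebraMap K (MvPolynomial ι K)))
  rw [IsScalarTower.algebraMap_eq K (MvPolynomial ι K) (Localization.Away f),
    CommRingCat.ofHom_comp, Spec.map_comp]
  exact basicOpenIsoSpecAway_hom_SpecMap_assoc
    (R := CommRingCat.of (MvPolynomial ι K)) f _

theorem locClass_of_isUnit {f : A} (hf : IsUnit f) : locClass K f = specClass K A :=
  have : IsLocalization.Away f A :=
    IsLocalization.away_of_isUnit_of_bijective A hf Function.bijective_id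
  locClass_eq_specClass f

theorem locClass_congr (φ : A ≃ₐ[K] B) (f : A) : locClass K f = locClass K (φ f) := by
  let _ := ((algebraMap B (Localization.Away (φ f))).comp φ.toRingHom).toAlgebra
  have : IsScalarTower K A (Localization.Away (φ f)) := .of_algebraMap_eq fun x => by
    rw [RingHom.algebraMap_toAlgebra]
    simp [IsScalarTower.algebraMap_apply K B (Localization.Away (φ f))]
  have : IsLocalization.Away f (Localization.Away (φ f)) := by
    have := IsLocalization.isLocalization_of_base_ringEquiv (Submonoid.powers (φ f))
      (Localization.Away (φ f)) φ.symm.toRingEquiv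
    rw [Submonoid.map_powers] at this
    have h : φ.symm.toRingEquiv (φ f) = f := φ.symm_apply_apply f
    exact h.subst (motive := fun g => IsLocalization (Submonoid.powers g) (Localization.Away (φ f)))
      this
  exact locClass_eq_specClass f

/-- Where f is invertible its divisor u is invertible already; this removes repeated factors. -/
theorem locClass_mul_of_dvd {f u : A} (h : u ∣ f) : locClass K (f * u) = locClass K f :=
  have : IsLocalization.Away (f * u) (Localization.Away f) :=
    IsLocalization.Away.mul_of_isUnit f u (IsLocalization.Away.isUnit_of_dvd f h)
  locClass_eq_specClass (B := Localization.Away f) (f * u)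

theorem locClass_neg (f : A) : locClass K (-f) = locClass K f := by
  rw [← locClass_mul_of_dvd (isUnit_one.neg.dvd : -1 ∣ f), mul_neg_one]

theorem locClass_mul (u f : A) [Algebra A B] [IsScalarTower K A B] [IsLocalization.Away u B] :
    locClass K (u * f) = locClass K (algebraMap A B f) := by
  have : IsScalarTower K A (Localization.Away (algebraMap A B f)) :=
    .of_algebraMap_eq fun x => by
      rw [IsScalarTower.algebraMap_apply K B, IsScalarTower.algebraMap_apply K A B,
        ← IsScalarTower.algebraMap_apply A B]
  have : IsLocalization.Away (u * f) (Localization.Away (algebraMap A B f)) :=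
    IsLocalization.Away.mul' B _ u f
  exact locClass_eq_specClass (u * f)

/-- Scissors relation inside the open subscheme `f ≠ 0`. -/
theorem locClass_eq_add {u : A} (f : A) (π : A →ₐ[K] B) (hπ : Function.Surjective π)
    (hker : RingHom.ker π = Ideal.span {u}) :
    locClass K f = locClass K (π f) + locClass K (f * u) := by
  rw [locClass_mul (B := Localization.Away f)]
  let π' : Localization.Away f →ₐ[K] Localization.Away (π f) :=
    IsLocalization.Away.mapₐ _ _ π f
  have hπ' : Function.Surjective π' :=
    IsLocalization.Away.mapₐ_surjective_of_surjective f hπ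
  refine specClass_eq_add (u := algebraMap A (Localization.Away f) u) π' hπ' ?_
  -- Localization is exact, so the kernel of the localized map is still generated by the image of u.
  have h := IsLocalization.ker_map (S := Localization.Away f) (Localization.Away (π f))
    (M := Submonoid.powers f) (T := Submonoid.powers (π f)) (g := π.toRingHom)
    (by rw [Submonoid.map_powers]; rfl)
  refine h.trans ?_
  change Ideal.map _ (RingHom.ker π) = _
  rw [hker, Ideal.map_span, Set.image_singleton]

theorem torusClass_eq : torusClass K = locClass K (X : K[X]) := by
  rw [torusClass, KVariety.motivicClass_hypersurfaceComplement,
    locClass_congr (MvPolynomial.uniqueAlgEquiv K PUnit)]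
  simp

/-- Scissors along the zero section X = 0 of the trivial line bundle over `Spec A`. -/
theorem locClass_polynomial_eq_add (p : A[X]) :
    locClass K p = locClass K (p.coeff 0) + locClass K (p * X) := by
  have h := locClass_eq_add (K := K) (u := X) p
    ((Polynomial.aeval (0 : A)).restrictScalars K) (fun a => ⟨C a, by simp⟩) (by
      ext q
      simp [RingHom.mem_ker, Ideal.mem_span_singleton, X_dvd_iff, coeff_zero_eq_aeval_zero])
  simpa [coeff_zero_eq_aeval_zero] using h

theorem specClass_polynomial_self : specClass K K[X] = torusClass K + 1 := by
  have h := locClass_polynomial_eq_add (K := K) (1 : K[X])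
  rw [locClass_of_isUnit isUnit_one, one_mul, ← torusClass_eq, coeff_one_zero,
    locClass_of_isUnit isUnit_one, specClass_self] at h
  rw [h, add_comm]

attribute [local instance] Polynomial.algebra in
theorem isLocalization_away_polynomial (u : A) (B : Type*) [CommRing B] [Algebra A B]
    [IsLocalization.Away u B] : IsLocalization.Away (C u : A[X]) B[X] := by
  have := Polynomial.isLocalization (Submonoid.powers u) B
  rwa [Submonoid.map_powers] at this

-- Inverting a constant commutes with adjoining a variable, so the locus is a product with the
-- affine line.
attribute [local instance] Polynomial.algebra in
theorem locClass_C (f : A) : locClass K (C f : A[X]) = (torusClass K + 1) * locClass K f := by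
  have := isLocalization_away_polynomial f (Localization.Away f)
  have : IsScalarTower K A[X] (Localization.Away f)[X] := .of_algebraMap_eq fun x => by
    simp [Polynomial.algebraMap_def,
      IsScalarTower.algebraMap_apply K A (Localization.Away f)]
  rw [locClass_eq_specClass (B := (Localization.Away f)[X]) (C f), specClass_polynomial,
    specClass_polynomial_self, mul_comm]
  rfl

theorem locClass_C_mul_X (f : A) : locClass K (C f * X : A[X]) = torusClass K * locClass K f := by
  have h := locClass_polynomial_eq_add (K := K) (C f)
  rw [locClass_C, coeff_C_zero] at h
  linear_combination -h

/-- On the open set where the constant `u` is invertible, a family of hypersurfaces may be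
translated by a fraction with denominator `u`. -/
theorem locClass_C_mul_of_translation (u : A) (p q : A[X])
    (c : Localization.Away u)
    (h : (p.map (algebraMap A (Localization.Away u))).comp (X + C c) =
      q.map (algebraMap A (Localization.Away u))) :
    locClass K (C u * p) = locClass K (C u * q) := by
  let _ := Polynomial.algebra A (Localization.Away u)
  have := isLocalization_away_polynomial u (Localization.Away u)
  have : IsScalarTower K A[X] (Localization.Away u)[X] := .of_algebraMap_eq fun x => by
    simp [Polynomial.algebraMap_def,
      IsScalarTower.algebraMap_apply K A (Localization.Away u)]
  rw [locClass_mul (B := (Localization.Away u)[X]), locClass_mul (B := (Localization.Away u)[X]),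
    -- Once u is inverted, X ↦ X + c is an automorphism of the polynomial ring.
    locClass_congr ((algEquivAevalXAddC c).restrictScalars K)]
  exact congrArg _ h

end AffineClass

/-! ### The class of the locus s(uF + H) - t²F ≠ 0 -/

section Crossing

open Polynomial

/-- Exchange of the innermost and the outermost variable. -/
noncomputable def trivariateSwap (A : Type*) [CommRing A] : A[X][X][X] ≃ₐ[A] A[X][X][X] :=
  -- The transposition (1 3) written as (1 2)(2 3)(1 2).
  ((Bivariate.swap (R := A[X])).restrictScalars A).trans
    ((mapAlgEquiv (Bivariate.swap (R := A))).trans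
      ((Bivariate.swap (R := A[X])).restrictScalars A))

theorem trivariateSwap_mul {A : Type*} [CommRing A] (F H : A) :
    trivariateSwap A (C (C X) * (X * C (C (C F)) + C (C (C H)))) = C (C (X * C F + C H)) * X := by
  simp [trivariateSwap, Bivariate.swap_apply]
  ring

/-- Setting the innermost variable to zero. -/
noncomputable def trivariateEval (K A : Type*) [CommRing K] [CommRing A] [Algebra K A] :
    A[X][X][X] →ₐ[K] A[X][X] :=
  mapAlgHom (mapAlgHom ((aeval (0 : A)).restrictScalars K))

theorem trivariateEval_surjective (K A : Type*) [CommRing K] [CommRing A] [Algebra K A] :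
    Function.Surjective (trivariateEval K A) :=
  map_surjective _ (map_surjective _ fun a => ⟨C a, by simp⟩)

theorem ker_trivariateEval (K A : Type*) [CommRing K] [CommRing A] [Algebra K A] :
    RingHom.ker (trivariateEval K A) = Ideal.span {C (C X)} := by
  have h : RingHom.ker (((aeval (0 : A)).restrictScalars K : A[X] →ₐ[K] A) : A[X] →+* A) =
      Ideal.span {X} := by
    ext q
    simp [RingHom.mem_ker, Ideal.mem_span_singleton, X_dvd_iff, coeff_zero_eq_aeval_zero]
  refine (ker_mapRingHom _).trans ?_
  refine (congrArg _ (ker_mapRingHom _)).trans ?_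
  refine (congrArg (fun I => Ideal.map _ (Ideal.map _ I)) h).trans ?_
  simp only [Ideal.map_span, Set.image_singleton]

variable {K : Type u} [Field K] {A : Type u} [CommRing A] [Algebra K A] [Algebra.FiniteType K A]

/-- The stratum s = 0: the outer variable u is free and the inner variable t must be nonzero. -/
theorem locClass_crossing_closed (F : A) : locClass K (-C (X ^ 2 * C F) : A[X][X]) =
    (torusClass K + 1) * torusClass K * locClass K F := by
  rw [locClass_neg, locClass_C, show (X ^ 2 * C F : A[X]) = C F * X * X by ring,
    locClass_mul_of_dvd (Dvd.intro_left _ rfl), locClass_C_mul_X, mul_assoc]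

/-- The stratum s ≠ 0 after the translation. The innermost variable s is moved outermost, where it
splits off as a factor 𝕋; the middle variable t is free. -/
theorem locClass_crossing_open (F H : A) :
    locClass K (C (C X) * (C (C X) * (X * C (C (C F)) + C (C (C H)))) : A[X][X][X]) =
      (torusClass K + 1) * torusClass K * locClass K (X * C F + C H : A[X]) := by
  rw [mul_comm (C (C X) : A[X][X][X]), locClass_mul_of_dvd (Dvd.intro _ rfl),
    locClass_congr (B := A[X][X][X]) ((trivariateSwap A).restrictScalars K)]
  change locClass K (trivariateSwap A _) = _
  rw [trivariateSwap_mul, locClass_C_mul_X, locClass_C]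
  ring

/-- From the outside inwards the variables are u, t, s. The locus is cut along s = 0, and on s ≠ 0
the term t²F is absorbed by a translation of u. -/
theorem locClass_crossing (F H : A) :
    locClass K (C (C X) * (X * C (C (C F)) + C (C (C H))) - C (X ^ 2 * C (C F)) : A[X][X][X]) =
      (torusClass K + 1) * torusClass K * (locClass K (X * C F + C H : A[X]) + locClass K F) := by
  have hP : trivariateEval K A
      (C (C X) * (X * C (C (C F)) + C (C (C H))) - C (X ^ 2 * C (C F))) =
        -C (X ^ 2 * C F) := by
    simp [trivariateEval, mapAlgHom]
  have htr := locClass_C_mul_of_translation (K := K) (C X : A[X][X])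
    (C (C X) * (X * C (C (C F)) + C (C (C H))) - C (X ^ 2 * C (C F)))
    (C (C X) * (X * C (C (C F)) + C (C (C H))))
    -- The translation is by t²/s, since s · (t²/s) · F cancels t²F.
    (algebraMap A[X][X] _ (X ^ 2) * IsLocalization.Away.invSelf (C X : A[X][X])) (by
      have h := congrArg (C : _ → (Localization.Away (C X : A[X][X]))[X])
        (IsLocalization.Away.mul_invSelf (S := Localization.Away (C X : A[X][X])) (C X : A[X][X]))
      simp only [Polynomial.map_sub, Polynomial.map_mul, Polynomial.map_add, Polynomial.map_pow,
        pow_comp, map_C, map_X,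
        sub_comp, mul_comp, add_comp, C_comp, X_comp, map_mul, map_pow, map_one] at h ⊢
      linear_combination C (algebraMap A[X][X] (Localization.Away (C X : A[X][X])) X) ^ 2 *
        C (algebraMap A[X][X] (Localization.Away (C X : A[X][X])) (C (C F))) * h)
  rw [locClass_eq_add (B := A[X][X]) (u := (C (C X) : A[X][X][X])) _ (trivariateEval K A)
    (trivariateEval_surjective K A)
    (ker_trivariateEval K A), hP, locClass_crossing_closed,
    mul_comm _ (C (C X) : A[X][X][X]), htr, locClass_crossing_open]
  ring

end Crossing

/-! ## Spanning forests and potentials -/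

namespace Graph

variable {α : Type v} {β : Type u}

/-- A function on the vertices is a potential for a set of edges if it takes the same value at
both ends of each of them. -/
def IsPotential (G : Graph α β) (F : Set β) (f : α → ZMod 2) : Prop :=
  ∀ i ∈ F, ∀ x y, G.IsLink i x y → f x = f y

theorem IsPotential.mono {G : Graph α β} {F F' : Set β} {f : α → ZMod 2}
    (h : G.IsPotential F' f) (hF : F ⊆ F') : G.IsPotential F f :=
  fun i hi => h i (hF hi)

theorem isPotential_const (G : Graph α β) (F : Set β) (c : ZMod 2) :
    G.IsPotential F fun _ => c :=
  fun _ _ _ _ _ => rfl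

theorem isPotential_union {G : Graph α β} {F F' : Set β} {f : α → ZMod 2} :
    G.IsPotential (F ∪ F') f ↔ G.IsPotential F f ∧ G.IsPotential F' f := by
  simp only [IsPotential, Set.mem_union, or_imp, forall_and]

theorem isPotential_insert {G : Graph α β} {F : Set β} {f : α → ZMod 2} {e : β} {a b : α}
    (he : G.IsLink e a b) :
    G.IsPotential (insert e F) f ↔ f a = f b ∧ G.IsPotential F f := by
  rw [Set.insert_eq, isPotential_union]
  refine and_congr_left fun _ => ⟨fun h => h e rfl a b he, ?_⟩
  rintro h _ rfl x y hxy
  rcases he.eq_and_eq_or_eq_and_eq hxy with ⟨rfl, rfl⟩ | ⟨rfl, rfl⟩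
  exacts [h, h.symm]

-- Potentials are constant along paths. Conversely the indicator function of the vertices reachable
-- from x is a potential, and it separates x from every vertex that is not reachable.
open scoped Classical in
theorem joined_restrict_iff {G : Graph α β} {F : Set β} {x y : α} :
    (G.restrict F).Joined x y ↔ ∀ f, G.IsPotential F f → f x = f y := by
  constructor
  · intro h f hf
    induction h with
    | refl => rfl
    | tail _ hyz ih =>
      obtain ⟨i, hi⟩ := hyz
      exact ih.trans (hf i hi.1 _ _ hi.2)
  · intro h
    have h' := h (fun z => if (G.restrict F).Joined x z then 1 else 0) (by
      intro i hi z w hzw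
      have hl : (G.restrict F).IsLink i z w := ⟨hi, hzw⟩
      have : (G.restrict F).Joined x z ↔ (G.restrict F).Joined x w :=
        ⟨fun hz => hz.tail ⟨i, hl⟩, fun hw => hw.tail ⟨i, hl.symm⟩⟩
      simp only [this])
    have hx : (G.restrict F).Joined x x := Relation.ReflTransGen.refl
    by_contra hy
    simp [hx, hy] at h'

theorem joined_iff {G : Graph α β} {x y : α} :
    G.Joined x y ↔ ∀ f, G.IsPotential E(G) f → f x = f y := by
  rw [← joined_restrict_iff, restrict_self]

theorem isBridgeEdge_restrict_iff {G : Graph α β} {F : Set β} {i : β} (hi : i ∈ F) :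
    (G.restrict F).IsBridgeEdge i ↔
      ∃ f, G.IsPotential (F \ {i}) f ∧ ∃ x y, G.IsLink i x y ∧ f x ≠ f y := by
  have h : (G.restrict F).deleteEdges {i} = G.restrict (F \ {i}) := by
    rw [← restrict_edgeSet_sdiff_eq_deleteEdges, restrict_restrict, ← restrict_edgeSet_inter]
    conv_rhs => rw [← restrict_edgeSet_inter]
    congr 1
    ext j
    simp only [edgeSet_restrict, Set.mem_inter_iff, Set.mem_sdiff]
    tauto
  simp only [IsBridgeEdge, h, joined_restrict_iff, not_forall]
  constructor
  · rintro ⟨x, y, hl, f, hf, hne⟩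
    exact ⟨f, hf, x, y, hl.2, hne⟩
  · rintro ⟨f, hf, x, y, hl, hne⟩
    exact ⟨x, y, ⟨hi, hl⟩, f, hf, hne⟩

/-- The ends of e are unique up to order, so one named pair suffices. In this form the hypothesis on
e says that potentials on the remaining edges extend over e. -/
theorem not_isBridgeEdge_iff {G : Graph α β} {e : β} {a b : α} (he : G.IsLink e a b) :
    ¬ G.IsBridgeEdge e ↔ ∀ f, G.IsPotential (E(G) \ {e}) f → f a = f b := by
  have h := isBridgeEdge_restrict_iff (G := G) he.edge_mem
  rw [restrict_self] at h
  rw [h]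
  constructor
  · intro h f hf
    by_contra hne
    exact h ⟨f, hf, a, b, he, hne⟩
  · rintro h ⟨f, hf, x, y, hl, hne⟩
    rcases he.eq_and_eq_or_eq_and_eq hl with ⟨rfl, rfl⟩ | ⟨rfl, rfl⟩
    exacts [hne (h f hf), hne (h f hf).symm]

/-- Spanning forests are the bases of the graphic matroid, expressed through potentials. -/
theorem isSpanningForest_iff {G : Graph α β} {F : Set β} :
    G.IsSpanningForest F ↔ F ⊆ E(G) ∧
      (∀ i ∈ F, ∃ f, G.IsPotential (F \ {i}) f ∧ ∃ x y, G.IsLink i x y ∧ f x ≠ f y) ∧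
      ∀ f, G.IsPotential F f → G.IsPotential E(G) f := by
  refine and_congr_right fun _ => and_congr
    (forall₂_congr fun i hi => isBridgeEdge_restrict_iff hi) ?_
  simp only [joined_iff (G := G), joined_restrict_iff]
  constructor
  · intro h f hf i hi x y hl
    exact h x y (fun g hg => hg i hi x y hl) f hf
  · intro h x y hxy f hf
    exact hxy f (h f hf)

/-! ### Replacing an edge by a gadget with two terminals -/

section Gadget

variable {W : Type v} {ι : Type u}

/-- A state of a gadget with two terminals and internal vertices `W`: the values of a potential
at the two terminals and at the internal vertices. -/
abbrev GadgetState (W : Type v) : Type v := ZMod 2 × ZMod 2 × (W → ZMod 2)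

/-- The state of the gadget given by a function on the vertices. -/
def gadgetState (a b : α) (f : α ⊕ W → ZMod 2) : GadgetState W :=
  (f (Sum.inl a), f (Sum.inl b), f ∘ Sum.inr)

/-- The edges `Q` form a spanning tree of the gadget. -/
def IsGadgetTree (δ : ι → GadgetState W →ₗ[ZMod 2] ZMod 2) (Q : Set ι) : Prop :=
  (∀ s, (∀ i ∈ Q, δ i s = 0) → s.1 = s.2.1 ∧ ∀ i, δ i s = 0) ∧
    ∀ i ∈ Q, ∃ s, (∀ j ∈ Q \ {i}, δ j s = 0) ∧ δ i s ≠ 0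

/-- The edges `Q` form a spanning forest of the gadget with two components that separate the
terminals. -/
def IsGadgetCut (δ : ι → GadgetState W →ₗ[ZMod 2] ZMod 2) (Q : Set ι) : Prop :=
  (∀ s, s.1 = s.2.1 → (∀ i ∈ Q, δ i s = 0) → ∀ i, δ i s = 0) ∧
    (∃ s, s.1 ≠ s.2.1 ∧ ∀ i ∈ Q, δ i s = 0) ∧
    ∀ i ∈ Q, ∃ s, s.1 = s.2.1 ∧ (∀ j ∈ Q \ {i}, δ j s = 0) ∧ δ i s ≠ 0

theorem IsGadgetCut.not_isGadgetTree {δ : ι → GadgetState W →ₗ[ZMod 2] ZMod 2} {Q : Set ι}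
    (h : IsGadgetCut δ Q) : ¬ IsGadgetTree δ Q := by
  rintro ⟨h', -⟩
  obtain ⟨s, hne, hs⟩ := h.2.1
  exact hne (h' s hs).1

/-- If independent edges stay independent after the terminals are identified, then they do not
join the terminals. -/
theorem exists_gadgetState_ne [Finite ι] {δ : ι → GadgetState W →ₗ[ZMod 2] ZMod 2} {Q : Set ι}
    (h : ∀ i ∈ Q, ∃ s : GadgetState W, s.1 = s.2.1 ∧ (∀ j ∈ Q \ {i}, δ j s = 0) ∧ δ i s ≠ 0) :
    ∃ s : GadgetState W, s.1 ≠ s.2.1 ∧ ∀ i ∈ Q, δ i s = 0 := by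
  classical
  have := Fintype.ofFinite ι
  choose! t ht₁ ht₂ ht₃ using h
  have ht₃ : ∀ i ∈ Q, δ i (t i) = 1 := fun i hi =>
    (by decide : ∀ x : ZMod 2, x ≠ 0 → x = 1) _ (ht₃ i hi)
  let s₀ : GadgetState W := (1, 0, 0)
  let d : GadgetState W →ₗ[ZMod 2] ZMod 2 :=
    LinearMap.fst _ _ _ - (LinearMap.fst _ _ _).comp (LinearMap.snd _ _ _)
  -- The states t i are dual to the forms δ i for i in Q, and their terminals agree. Subtracting
  -- them makes every form in Q vanish without changing the difference 1 between the terminals of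
  -- s₀.
  let s := s₀ - ∑ i ∈ Finset.univ.filter (· ∈ Q), δ i s₀ • t i
  refine ⟨s, ?_, fun j hj => ?_⟩
  · have hd : d s = 1 := by
      simp only [s, map_sub, map_sum, map_smul]
      rw [Finset.sum_eq_zero]
      · simp [d, s₀]
      · intro i hi
        simp [d, ht₁ i (Finset.mem_filter.mp hi).2]
    intro h
    have : d s = s.1 - s.2.1 := rfl
    rw [hd, h, sub_self] at this
    exact one_ne_zero this
  · simp only [s, map_sub, map_sum, map_smul]
    rw [Finset.sum_eq_single_of_mem j (by simpa using hj)]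
    · simp [ht₃ j hj]
    · intro i hi hij
      rw [ht₂ i (Finset.mem_filter.mp hi).2 j ⟨hj, hij.symm⟩, smul_zero]

variable {G : Graph α β} {e : β} {a b : α} {ends : ι → Sym2 (α ⊕ W)}
  {hends : ∀ i x, Sum.inl x ∈ ends i → x ∈ V(G)}

theorem isPotential_replaceEdge_inl {S : Set β} (hS : S ⊆ E(G) \ {e}) {f : α ⊕ W → ZMod 2} :
    (G.replaceEdge e ends hends).IsPotential (Sum.inl '' S) f ↔
      G.IsPotential S (f ∘ Sum.inl) := by
  constructor
  · intro h i hi x y hl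
    exact h _ ⟨i, hi, rfl⟩ _ _ (Or.inl ⟨i, x, y, rfl, rfl, rfl, (hS hi).2, hl⟩)
  · rintro h _ ⟨i, hi, rfl⟩ p q (⟨j, x, y, hj, rfl, rfl, -, hl⟩ | ⟨j, hj, -⟩)
    · cases hj
      exact h i hi x y hl
    · cases hj

/-- The linear forms `δ` describe the differences of potentials along the edges of the gadget. -/
def IsGadget (a b : α) (ends : ι → Sym2 (α ⊕ W))
    (δ : ι → GadgetState W →ₗ[ZMod 2] ZMod 2) : Prop :=
  (∀ i c, δ i (c, c, fun _ => c) = 0) ∧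
    ∀ i (f : α ⊕ W → ZMod 2) p q, ends i = s(p, q) → (f p = f q ↔ δ i (gadgetState a b f) = 0)

theorem exists_link_ne_inl_iff {i : β} (hi : i ∈ E(G) \ {e}) {f : α ⊕ W → ZMod 2} :
    (∃ p q, (G.replaceEdge e ends hends).IsLink (Sum.inl i) p q ∧ f p ≠ f q) ↔
      ∃ x y, G.IsLink i x y ∧ f (Sum.inl x) ≠ f (Sum.inl y) := by
  constructor
  · rintro ⟨p, q, ⟨j, x, y, hj, rfl, rfl, -, hl⟩ | ⟨j, hj, -⟩, hne⟩
    · cases hj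
      exact ⟨x, y, hl, hne⟩
    · cases hj
  · rintro ⟨x, y, hl, hne⟩
    exact ⟨_, _, Or.inl ⟨i, x, y, rfl, rfl, rfl, hi.2, hl⟩, hne⟩

variable {δ : ι → GadgetState W →ₗ[ZMod 2] ZMod 2}

theorem IsGadget.isPotential_inr (hδ : IsGadget a b ends δ) {Q : Set ι} {f : α ⊕ W → ZMod 2} :
    (G.replaceEdge e ends hends).IsPotential (Sum.inr '' Q) f ↔
      ∀ i ∈ Q, δ i (gadgetState a b f) = 0 := by
  constructor
  · intro h i hi
    induction hpq : ends i with
    | _ p q => exact (hδ.2 i f p q hpq).1 (h _ ⟨i, hi, rfl⟩ p q (Or.inr ⟨i, rfl, hpq⟩))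
  · rintro h _ ⟨i, hi, rfl⟩ p q (⟨j, x, y, hj, -⟩ | ⟨j, hj, hpq⟩)
    · cases hj
    · cases hj
      exact (hδ.2 i f p q hpq).2 (h i hi)

theorem IsGadget.exists_link_ne_inr_iff (hδ : IsGadget a b ends δ) {i : ι}
    {f : α ⊕ W → ZMod 2} :
    (∃ p q, (G.replaceEdge e ends hends).IsLink (Sum.inr i) p q ∧ f p ≠ f q) ↔
      δ i (gadgetState a b f) ≠ 0 := by
  constructor
  · rintro ⟨p, q, ⟨j, x, y, hj, -⟩ | ⟨j, hj, hpq⟩, hne⟩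
    · cases hj
    · cases hj
      exact mt (hδ.2 i f p q hpq).2 hne
  · intro h
    induction hpq : ends i with
    | _ p q => exact ⟨p, q, Or.inr ⟨i, rfl, hpq⟩, mt (hδ.2 i f p q hpq).1 h⟩

/-- Spanning forests of a graph with one edge replaced by a gadget, in terms of potentials. -/
theorem IsGadget.isSpanningForest_replaceEdge_iff (hδ : IsGadget a b ends δ) {S : Set β}
    (hS : S ⊆ E(G) \ {e}) {Q : Set ι} :
    (G.replaceEdge e ends hends).IsSpanningForest (Sum.inl '' S ∪ Sum.inr '' Q) ↔
      (∀ i ∈ S, ∃ g w, G.IsPotential (S \ {i}) g ∧ (∀ j ∈ Q, δ j (g a, g b, w) = 0) ∧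
        ∃ x y, G.IsLink i x y ∧ g x ≠ g y) ∧
      (∀ i ∈ Q, ∃ g w, G.IsPotential S g ∧ (∀ j ∈ Q \ {i}, δ j (g a, g b, w) = 0) ∧
        δ i (g a, g b, w) ≠ 0) ∧
      ∀ g w, G.IsPotential S g → (∀ j ∈ Q, δ j (g a, g b, w) = 0) →
        G.IsPotential (E(G) \ {e}) g ∧ ∀ j, δ j (g a, g b, w) = 0 := by
  have hsub : Sum.inl '' S ∪ Sum.inr '' Q ⊆ E(G.replaceEdge e ends hends) :=
    Set.union_subset_union (Set.image_mono hS) (Set.image_subset_range _ _)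
  have hinl : ∀ i ∈ S, (Sum.inl '' S ∪ Sum.inr '' Q) \ {Sum.inl i} =
      Sum.inl '' (S \ {i}) ∪ (Sum.inr '' Q : Set (β ⊕ ι)) := by
    intro i _
    ext (j | j) <;> simp
  have hinr : ∀ i ∈ Q, (Sum.inl '' S ∪ Sum.inr '' Q) \ {Sum.inr i} =
      Sum.inl '' S ∪ (Sum.inr '' (Q \ {i}) : Set (β ⊕ ι)) := by
    intro i _
    ext (j | j) <;> simp
  have hE : E(G.replaceEdge e ends hends) =
      Sum.inl '' (E(G) \ {e}) ∪ Sum.inr '' (Set.univ : Set ι) := by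
    rw [Set.image_univ]; rfl
  rw [isSpanningForest_iff, and_iff_right hsub]
  constructor
  · rintro ⟨h₁, h₂⟩
    refine ⟨fun i hi => ?_, fun i hi => ?_, fun g w hg hw => ?_⟩
    · obtain ⟨f, hf, hne⟩ := h₁ (Sum.inl i) (Or.inl ⟨i, hi, rfl⟩)
      rw [hinl i hi, isPotential_union, isPotential_replaceEdge_inl (Set.sdiff_subset.trans hS),
        hδ.isPotential_inr] at hf
      exact ⟨_, _, hf.1, hf.2, (exists_link_ne_inl_iff (hS hi)).1 hne⟩
    · obtain ⟨f, hf, hne⟩ := h₁ (Sum.inr i) (Or.inr ⟨i, hi, rfl⟩)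
      rw [hinr i hi, isPotential_union, isPotential_replaceEdge_inl hS, hδ.isPotential_inr] at hf
      exact ⟨_, _, hf.1, hf.2, hδ.exists_link_ne_inr_iff.1 hne⟩
    · have h := h₂ (Sum.elim g w)
      rw [hE, isPotential_union, isPotential_replaceEdge_inl hS, hδ.isPotential_inr,
        isPotential_union, isPotential_replaceEdge_inl subset_rfl, hδ.isPotential_inr] at h
      have h := h ⟨hg, hw⟩
      exact ⟨h.1, fun j => h.2 j trivial⟩
  · rintro ⟨h₁, h₂, h₃⟩
    refine ⟨?_, fun f hf => ?_⟩
    · rintro _ (⟨i, hi, rfl⟩ | ⟨i, hi, rfl⟩)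
      · obtain ⟨g, w, hg, hw, hne⟩ := h₁ i hi
        refine ⟨Sum.elim g w, ?_, (exists_link_ne_inl_iff (hS hi)).2 hne⟩
        rw [hinl i hi, isPotential_union, isPotential_replaceEdge_inl (Set.sdiff_subset.trans hS),
          hδ.isPotential_inr]
        exact ⟨hg, hw⟩
      · obtain ⟨g, w, hg, hw, hne⟩ := h₂ i hi
        refine ⟨Sum.elim g w, ?_, hδ.exists_link_ne_inr_iff.2 hne⟩
        rw [hinr i hi, isPotential_union, isPotential_replaceEdge_inl hS, hδ.isPotential_inr]
        exact ⟨hg, hw⟩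
    · rw [isPotential_union, isPotential_replaceEdge_inl hS, hδ.isPotential_inr] at hf
      rw [hE, isPotential_union, isPotential_replaceEdge_inl subset_rfl, hδ.isPotential_inr]
      have h := h₃ _ _ hf.1 hf.2
      exact ⟨h.1, fun j _ => h.2 j⟩

/-- Potentials for the edges other than e agree at its ends, as e is not a bridge, so e imposes no
further spanning condition. -/
theorem isSpanningForest_iff_of_not_isBridgeEdge (he : G.IsLink e a b)
    (hbridge : ¬ G.IsBridgeEdge e) {S : Set β} (hS : S ⊆ E(G) \ {e}) :
    G.IsSpanningForest S ↔
      (∀ i ∈ S, ∃ g, G.IsPotential (S \ {i}) g ∧ ∃ x y, G.IsLink i x y ∧ g x ≠ g y) ∧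
      ∀ g, G.IsPotential S g → G.IsPotential (E(G) \ {e}) g := by
  rw [isSpanningForest_iff, and_iff_right (hS.trans Set.sdiff_subset)]
  refine and_congr_right fun _ => forall₂_congr fun g _ => ⟨fun h => h.mono Set.sdiff_subset,
    fun h => ?_⟩
  have := (isPotential_insert he).2 ⟨(not_isBridgeEdge_iff he).1 hbridge g h, h⟩
  exact this.mono (by simp)

/-- Potentials with equal values at a and b are the potentials of the contraction by e; the middle
clause says that S does not itself join a to b. -/
theorem isSpanningForest_insert_iff (he : G.IsLink e a b) {S : Set β} (hS : S ⊆ E(G) \ {e}) :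
    G.IsSpanningForest (insert e S) ↔
      (∀ i ∈ S, ∃ g, G.IsPotential (S \ {i}) g ∧ g a = g b ∧
        ∃ x y, G.IsLink i x y ∧ g x ≠ g y) ∧
      (∃ g, G.IsPotential S g ∧ g a ≠ g b) ∧
      ∀ g, G.IsPotential S g → g a = g b → G.IsPotential (E(G) \ {e}) g := by
  have heS : e ∉ S := fun h => (hS h).2 rfl
  have hE : insert e (E(G) \ {e}) = E(G) := by
    rw [Set.insert_sdiff_singleton, Set.insert_eq_of_mem he.edge_mem]
  rw [isSpanningForest_iff, and_iff_right
    (Set.insert_subset he.edge_mem (hS.trans Set.sdiff_subset)), Set.forall_mem_insert]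
  have h₀ : (insert e S) \ {e} = S := Set.insert_sdiff_self_of_notMem heS
  have h₁ : ∀ i ∈ S, (insert e S) \ {i} = insert e (S \ {i}) := fun i hi =>
    Set.insert_sdiff_of_notMem _ (fun h => heS (h ▸ hi))
  rw [h₀, and_assoc, and_left_comm]
  refine and_congr (forall₂_congr fun i hi => ?_) (and_congr ?_ (forall_congr' fun g => ?_))
  · rw [h₁ i hi]
    simp only [isPotential_insert he]
    exact exists_congr fun g => by tauto
  · refine exists_congr fun g => and_congr_right fun _ => ⟨?_, fun h => ⟨a, b, he, h⟩⟩
    rintro ⟨x, y, hl, hne⟩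
    rcases he.eq_and_eq_or_eq_and_eq hl with ⟨rfl, rfl⟩ | ⟨rfl, rfl⟩
    exacts [hne, hne.symm]
  · rw [← hE, isPotential_insert he, isPotential_insert he, hE]
    tauto

/-- Spanning forests of a graph with a non-bridge edge replaced by a gadget. -/
theorem IsGadget.isSpanningForest_replaceEdge [Finite ι] (hδ : IsGadget a b ends δ)
    (he : G.IsLink e a b) (hbridge : ¬ G.IsBridgeEdge e) {S : Set β} (hS : S ⊆ E(G) \ {e})
    {Q : Set ι} :
    (G.replaceEdge e ends hends).IsSpanningForest (Sum.inl '' S ∪ Sum.inr '' Q) ↔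
      (IsGadgetCut δ Q ∧ G.IsSpanningForest S) ∨
        (IsGadgetTree δ Q ∧ G.IsSpanningForest (insert e S)) := by
  -- Over `ZMod 2` two pairs of distinct terminal values differ at most by the flip z ↦ 1 - z. The
  -- flip preserves potentials and the gadget forms, so any two separating states can be matched.
  have hflip : ∀ {x y x' y' : ZMod 2}, x ≠ y → x' ≠ y' →
      (x = x' ∧ y = y') ∨ (x = 1 - x' ∧ y = 1 - y') := by decide
  have hneg : ∀ i (x y : ZMod 2) (w : W → ZMod 2),
      δ i (1 - x, 1 - y, fun j => 1 - w j) = δ i (x, y, w) := by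
    intro i x y w
    have : ((1 - x, 1 - y, fun j => 1 - w j) : GadgetState W) = (1, 1, fun _ => 1) - (x, y, w) :=
      rfl
    rw [this, map_sub, hδ.1, zero_sub, ZMod.neg_eq_self_mod_two]
  have hgneg : ∀ {F : Set β} {g : α → ZMod 2}, G.IsPotential F g →
      G.IsPotential F fun x => 1 - g x :=
    fun h i hi x y hl => congrArg (1 - ·) (h i hi x y hl)
  have hnb := (not_isBridgeEdge_iff he).1 hbridge
  rw [hδ.isSpanningForest_replaceEdge_iff hS,
    isSpanningForest_iff_of_not_isBridgeEdge he hbridge hS, isSpanningForest_insert_iff he hS]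
  constructor
  · rintro ⟨h₁, h₂, h₃⟩
    -- The two cases are whether Q leaves the terminals separated (a cut) or joins them (a tree).
    by_cases hQ : ∃ s : GadgetState W, s.1 ≠ s.2.1 ∧ ∀ i ∈ Q, δ i s = 0
    · left
      -- Any potential g for S extends to the gadget: by a constant if g a = g b, and otherwise by
      -- the separating state, flipped if necessary.
      have hspan : ∀ g, G.IsPotential S g → G.IsPotential (E(G) \ {e}) g := by
        intro g hg
        by_cases hab : g a = g b
        · exact (h₃ g (fun _ => g a) hg fun j _ => by rw [← hab]; exact hδ.1 j _).1
        · obtain ⟨⟨x, y, w⟩, hne, hw⟩ := hQ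
          rcases hflip hab hne with ⟨hx, hy⟩ | ⟨hx, hy⟩
          · exact (h₃ g w hg fun j hj => by rw [hx, hy]; exact hw j hj).1
          · refine (h₃ g (fun j => 1 - w j) hg fun j hj => ?_).1
            rw [hx, hy, hneg]
            exact hw j hj
      refine ⟨⟨?_, hQ, ?_⟩, ?_, hspan⟩
      · rintro ⟨x, y, w⟩ hxy hw
        obtain rfl : x = y := hxy
        exact (h₃ (fun _ => x) w (isPotential_const G S x) hw).2
      · intro i hi
        obtain ⟨g, w, hg, hw, hne⟩ := h₂ i hi
        exact ⟨(g a, g b, w), hnb g (hspan g hg), hw, hne⟩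
      · intro i hi
        obtain ⟨g, w, hg, -, hne⟩ := h₁ i hi
        exact ⟨g, hg, hne⟩
    · right
      have hQ' : ∀ x y w, (∀ i ∈ Q, δ i (x, y, w) = 0) → x = y := by
        intro x y w h
        by_contra hxy
        exact hQ ⟨(x, y, w), hxy, h⟩
      refine ⟨⟨?_, ?_⟩, ?_, ?_, ?_⟩
      · rintro ⟨x, y, w⟩ hw
        obtain rfl := hQ' x y w hw
        exact ⟨rfl, (h₃ (fun _ => x) w (isPotential_const G S x) hw).2⟩
      · intro i hi
        obtain ⟨g, w, -, hw, hne⟩ := h₂ i hi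
        exact ⟨_, hw, hne⟩
      · intro i hi
        obtain ⟨g, w, hg, hw, hne⟩ := h₁ i hi
        exact ⟨g, hg, hQ' _ _ w hw, hne⟩
      -- If S joined a to b, then Q would stay independent after identifying the terminals, and
      -- hence would not join them.
      · by_contra hS'
        push Not at hS'
        refine hQ (exists_gadgetState_ne fun i hi => ?_)
        obtain ⟨g, w, hg, hw, hne⟩ := h₂ i hi
        exact ⟨(g a, g b, w), hS' g hg, hw, hne⟩
      · intro g hg hab
        exact (h₃ g (fun _ => g a) hg fun j _ => by rw [← hab]; exact hδ.1 j _).1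
  · rintro (⟨⟨c₁, ⟨⟨x, y, w⟩, hxy, hw⟩, c₃⟩, h₁, h₂⟩ | ⟨⟨t₁, t₂⟩, h₁, ⟨g₀, hg₀, hab₀⟩, h₃⟩)
    · refine ⟨fun i hi => ?_, fun i hi => ?_, fun g w' hg hw' => ?_⟩
      · obtain ⟨g, hg, hne⟩ := h₁ i hi
        by_cases hab : g a = g b
        · exact ⟨g, fun _ => g a, hg, fun j _ => by rw [← hab]; exact hδ.1 j _, hne⟩
        · rcases hflip hab hxy with ⟨hx, hy⟩ | ⟨hx, hy⟩
          · exact ⟨g, w, hg, fun j hj => by rw [hx, hy]; exact hw j hj, hne⟩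
          · refine ⟨g, fun j => 1 - w j, hg, fun j hj => ?_, hne⟩
            rw [hx, hy, hneg]
            exact hw j hj
      · obtain ⟨⟨x', y', w'⟩, hxy', hw', hne⟩ := c₃ i hi
        obtain rfl : x' = y' := hxy'
        exact ⟨fun _ => x', w', isPotential_const G S x', hw', hne⟩
      · have hg' := h₂ g hg
        exact ⟨hg', c₁ _ (hnb g hg') hw'⟩
    · refine ⟨fun i hi => ?_, fun i hi => ?_, fun g w hg hw => ?_⟩
      · obtain ⟨g, hg, hab, hne⟩ := h₁ i hi
        exact ⟨g, fun _ => g a, hg, fun j _ => by rw [← hab]; exact hδ.1 j _, hne⟩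
      · obtain ⟨⟨x, y, w⟩, hw, hne⟩ := t₂ i hi
        by_cases hxy : x = y
        · subst hxy
          exact ⟨fun _ => x, w, isPotential_const G S x, hw, hne⟩
        · rcases hflip hxy hab₀ with ⟨hx, hy⟩ | ⟨hx, hy⟩
          · exact ⟨g₀, w, hg₀, by rwa [← hx, ← hy], by rwa [← hx, ← hy]⟩
          · subst hx hy
            exact ⟨fun x => 1 - g₀ x, w, hgneg hg₀, hw, hne⟩
      · have ht := t₁ _ hw
        exact ⟨h₃ g hg ht.1, ht.2⟩

end Gadget

end Graph

/-! ## Kirchhoff polynomials of gadget replacements -/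

/-- A product over the whole type can be reindexed along an equivalence and split over a sum type.
-/
theorem Finset.prod_compl_eq_prod_ite {X B : Type*} [Fintype X] [DecidableEq X] [CommMonoid B]
    (T : Finset X) (f : X → B) : ∏ i ∈ Tᶜ, f i = ∏ i, if i ∈ T then 1 else f i := by
  rw [Finset.compl_eq_univ_sdiff, Finset.sdiff_eq_filter, Finset.prod_filter]
  simp only [ite_not]

namespace Graph

open scoped Classical in
/-- The Kirchhoff polynomial evaluated along a decomposition of the set of edges. -/
theorem aeval_kirchhoffPolynomial {K : Type u} [Field K] {α : Type v} {β : Type u}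
    (G : Graph α β) [Finite E(G)] {E' ι : Type*} [Fintype E'] [Fintype ι]
    [DecidableEq E'] [DecidableEq ι] (σ : E' ⊕ ι ≃ E(G))
    {B : Type*} [CommRing B] [Algebra K B] (v : E(G) → B) :
    MvPolynomial.aeval v (G.kirchhoffPolynomial K) = ∑ S : Finset E', ∑ Q : Finset ι,
      if G.IsSpanningForest ((fun i => (σ (Sum.inl i)).1) '' S ∪ (fun i => (σ (Sum.inr i)).1) '' Q)
      then (∏ i ∈ Sᶜ, v (σ (Sum.inl i))) * ∏ i ∈ Qᶜ, v (σ (Sum.inr i)) else 0 := by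
  let _ := Fintype.ofFinite E(G)
  rw [kirchhoffPolynomial, map_sum, Finset.sum_filter, ← Fintype.sum_prod_type']
  refine (Fintype.sum_equiv
    (Finset.sumEquiv.symm.toEquiv.trans (Equiv.finsetCongr σ)) _ _ ?_).symm
  rintro ⟨S, Q⟩
  have hset : Subtype.val '' (((Finset.sumEquiv.symm.toEquiv.trans (Equiv.finsetCongr σ)) (S, Q) :
      Finset E(G)) : Set E(G)) =
      (fun i => (σ (Sum.inl i)).1) '' S ∪ (fun i => (σ (Sum.inr i)).1) '' Q := by
    have : (((Finset.sumEquiv.symm.toEquiv.trans (Equiv.finsetCongr σ)) (S, Q) :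
      Finset E(G)) : Set E(G)) = σ '' (Sum.inl '' S ∪ Sum.inr '' Q) := by
      ext x
      simp [Finset.sumEquiv, Finset.mem_disjSum]
    rw [this, Set.image_union, Set.image_union]
    simp only [Set.image_image]
  rw [hset]
  refine if_congr Iff.rfl ?_ rfl
  simp only [map_prod, MvPolynomial.aeval_X]
  rw [Finset.prod_compl_eq_prod_ite, Finset.prod_compl_eq_prod_ite,
    Finset.prod_compl_eq_prod_ite, ← Equiv.prod_comp σ, Fintype.prod_sum_type]
  simp [Finset.sumEquiv]

/-! ### Deletion and contraction parts of the Kirchhoff polynomial -/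

section Polynomials

variable (K : Type u) [Field K] {α : Type v} {β : Type u} (G : Graph α β) (e : β)
  [Fintype ↥(E(G) \ {e})]

open scoped Classical in
/-- The sum over the spanning forests that do not contain `e`. -/
noncomputable def deletionPolynomial : MvPolynomial ↥(E(G) \ {e}) K :=
  ∑ S : Finset ↥(E(G) \ {e}), if G.IsSpanningForest (Subtype.val '' (S : Set ↥(E(G) \ {e})))
    then ∏ i ∈ Sᶜ, MvPolynomial.X i else 0

open scoped Classical in
/-- The sum over the spanning forests that contain `e`. -/
noncomputable def contractionPolynomial : MvPolynomial ↥(E(G) \ {e}) K :=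
  ∑ S : Finset ↥(E(G) \ {e}),
    if G.IsSpanningForest (insert e (Subtype.val '' (S : Set ↥(E(G) \ {e}))))
    then ∏ i ∈ Sᶜ, MvPolynomial.X i else 0

variable {K G e} {B : Type*} [CommRing B] [Algebra K B]

/-- The edges of a graph are a given edge and the other ones. -/
noncomputable def edgeSplit (he : e ∈ E(G)) : ↥(E(G) \ {e}) ⊕ PUnit.{u + 1} ≃ E(G) :=
  Equiv.ofBijective (Sum.elim (fun i => ⟨i.1, i.2.1⟩) fun _ => ⟨e, he⟩) (by
    constructor
    · rintro (i | i) (j | j) h <;> simp at h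
      · rw [Subtype.ext h]
      · exact (i.2.2 h).elim
      · exact (j.2.2 h.symm).elim
      · rfl
    · rintro ⟨i, hi⟩
      by_cases h : i = e
      · subst h
        exact ⟨Sum.inr PUnit.unit, rfl⟩
      · exact ⟨Sum.inl ⟨i, hi, h⟩, rfl⟩)

/-- Deletion and contraction of an edge. -/
theorem aeval_kirchhoffPolynomial_edgeSplit [Finite E(G)] (he : e ∈ E(G)) (v : E(G) → B) :
    MvPolynomial.aeval v (G.kirchhoffPolynomial K) =
      v ⟨e, he⟩ * MvPolynomial.aeval (fun i => v (edgeSplit he (Sum.inl i)))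
          (G.deletionPolynomial K e) +
        MvPolynomial.aeval (fun i => v (edgeSplit he (Sum.inl i)))
          (G.contractionPolynomial K e) := by
  classical
  rw [G.aeval_kirchhoffPolynomial (edgeSplit he), deletionPolynomial, contractionPolynomial,
    map_sum, map_sum, Finset.mul_sum, ← Finset.sum_add_distrib]
  refine Finset.sum_congr rfl fun S _ => ?_
  -- The empty subset stands for forests avoiding e and contributes the factor t_e; the full subset
  -- contributes 1.
  have huniv : (Finset.univ : Finset (Finset PUnit.{u + 1})) = {∅, {PUnit.unit}} := rfl
  have h₁ : (fun i => (edgeSplit he (Sum.inl i)).1) '' (S : Set ↥(E(G) \ {e})) =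
    Subtype.val '' (S : Set ↥(E(G) \ {e})) := rfl
  have h₂ : (edgeSplit he (Sum.inr PUnit.unit)) = ⟨e, he⟩ := rfl
  rw [huniv, Finset.sum_pair (by simp), h₁]
  simp only [Finset.coe_empty, Finset.coe_singleton, Set.image_empty, Set.image_singleton,
    Set.union_empty, Set.union_singleton, h₂, apply_ite (MvPolynomial.aeval _), map_prod, map_zero,
    MvPolynomial.aeval_X, Finset.compl_empty, Finset.univ_unique, Finset.prod_singleton]
  have h₃ : ({PUnit.unit} : Finset PUnit.{u + 1})ᶜ = ∅ := rfl
  rw [h₃, Finset.prod_empty, mul_one, mul_ite, mul_zero, mul_comm (v _)]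

variable {W : Type v} {ι : Type u} {a b : α} {ends : ι → Sym2 (α ⊕ W)}
  {hends : ∀ i x, Sum.inl x ∈ ends i → x ∈ V(G)}
  {δ : ι → GadgetState W →ₗ[ZMod 2] ZMod 2}

/-- The edges of a graph with an edge replaced by a gadget. -/
noncomputable def replaceEdgeSplit (G : Graph α β) (e : β) (ends : ι → Sym2 (α ⊕ W))
    (hends : ∀ i x, Sum.inl x ∈ ends i → x ∈ V(G)) :
    ↥(E(G) \ {e}) ⊕ ι ≃ E(G.replaceEdge e ends hends) :=
  Equiv.ofBijective
    (Sum.elim (fun i => ⟨Sum.inl i.1, Or.inl ⟨i.1, i.2, rfl⟩⟩)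
      fun j => ⟨Sum.inr j, Or.inr ⟨j, rfl⟩⟩) (by
    constructor
    · rintro (i | i) (j | j) h <;> have h := congrArg Subtype.val h
      · exact congrArg _ (Subtype.ext (Sum.inl.inj h))
      · cases h
      · cases h
      · exact congrArg _ (Sum.inr.inj h)
    · rintro ⟨_, ⟨i, hi, rfl⟩ | ⟨j, rfl⟩⟩
      · exact ⟨Sum.inl ⟨i, hi⟩, rfl⟩
      · exact ⟨Sum.inr j, rfl⟩)

open scoped Classical in
/-- The Kirchhoff polynomial of a graph with a non-bridge edge replaced by a gadget. -/
theorem IsGadget.aeval_kirchhoffPolynomial [Fintype ι] [DecidableEq ι]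
    [Finite E(G.replaceEdge e ends hends)] (hδ : IsGadget a b ends δ) (he : G.IsLink e a b)
    (hbridge : ¬ G.IsBridgeEdge e) (v : E(G.replaceEdge e ends hends) → B) :
    MvPolynomial.aeval v ((G.replaceEdge e ends hends).kirchhoffPolynomial K) =
      (∑ Q : Finset ι, if IsGadgetCut δ (Q : Set ι) then
          ∏ i ∈ Qᶜ, v (replaceEdgeSplit G e ends hends (Sum.inr i)) else 0) *
        MvPolynomial.aeval (fun i => v (replaceEdgeSplit G e ends hends (Sum.inl i)))
          (G.deletionPolynomial K e) +
      (∑ Q : Finset ι, if IsGadgetTree δ (Q : Set ι) then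
          ∏ i ∈ Qᶜ, v (replaceEdgeSplit G e ends hends (Sum.inr i)) else 0) *
        MvPolynomial.aeval (fun i => v (replaceEdgeSplit G e ends hends (Sum.inl i)))
          (G.contractionPolynomial K e) := by
  rw [Graph.aeval_kirchhoffPolynomial _ (replaceEdgeSplit G e ends hends), deletionPolynomial,
    contractionPolynomial, map_sum, map_sum, Finset.mul_sum, Finset.mul_sum,
    ← Finset.sum_add_distrib]
  refine Finset.sum_congr rfl fun S _ => ?_
  rw [Finset.sum_mul, Finset.sum_mul, ← Finset.sum_add_distrib]
  refine Finset.sum_congr rfl fun Q _ => ?_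
  have hS : Subtype.val '' (S : Set ↥(E(G) \ {e})) ⊆ E(G) \ {e} := by
    rintro _ ⟨i, -, rfl⟩
    exact i.2
  have h := hδ.isSpanningForest_replaceEdge (hends := hends) he hbridge hS (Q := (Q : Set ι))
  rw [Set.image_image] at h
  refine (if_congr h rfl rfl).trans ?_
  -- The two alternatives exclude each other, so the disjunction becomes a sum with no double
  -- counting.
  have hex : IsGadgetCut δ (Q : Set ι) → ¬ IsGadgetTree δ (Q : Set ι) :=
    IsGadgetCut.not_isGadgetTree
  simp only [apply_ite (MvPolynomial.aeval _), map_prod, map_zero, MvPolynomial.aeval_X]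
  generalize ∏ i ∈ Sᶜ, v (replaceEdgeSplit G e ends hends (Sum.inl i)) = x
  generalize ∏ i ∈ Qᶜ, v (replaceEdgeSplit G e ends hends (Sum.inr i)) = y
  by_cases hc : IsGadgetCut δ (Q : Set ι)
  · simp [hc, hex hc, mul_comm]
  · simp only [hc, false_and, false_or, if_false, zero_mul, ite_self, zero_add, ite_mul, mul_ite,
      mul_zero, ite_and, mul_comm y x]
    split_ifs <;> simp

end Polynomials

/-- A polynomial ring over a decomposed set of variables, with one part of the variables
expressed by other coordinates. -/
noncomputable def gluingEquiv {K : Type*} [Field K] {E E' ι : Type*} (σ : E' ⊕ ι ≃ E)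
    {B : Type*} [CommRing B] [Algebra K B] [Algebra (MvPolynomial E' K) B]
    [IsScalarTower K (MvPolynomial E' K) B]
    (ψ : MvPolynomial ι (MvPolynomial E' K) ≃ₐ[MvPolynomial E' K] B) :
    MvPolynomial E K ≃ₐ[K] B :=
  (MvPolynomial.renameEquiv K (σ.symm.trans (Equiv.sumComm _ _))).trans
    ((MvPolynomial.sumAlgEquiv K ι E').trans (ψ.restrictScalars K))

/-- Both sides are algebra maps that agree on the variables. As an evaluation, the coordinate change
can be fed to the formulas for `aeval` of Kirchhoff polynomials. -/
theorem gluingEquiv_apply {K : Type*} [Field K] {E E' ι : Type*} (σ : E' ⊕ ι ≃ E)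
    {B : Type*} [CommRing B] [Algebra K B] [Algebra (MvPolynomial E' K) B]
    [IsScalarTower K (MvPolynomial E' K) B]
    (ψ : MvPolynomial ι (MvPolynomial E' K) ≃ₐ[MvPolynomial E' K] B) (p : MvPolynomial E K) :
    gluingEquiv σ ψ p = MvPolynomial.aeval (fun i => Sum.elim
      (fun j => algebraMap (MvPolynomial E' K) B (MvPolynomial.X j))
      (fun j => ψ (MvPolynomial.X j)) (σ.symm i)) p := by
  have : (gluingEquiv σ ψ : MvPolynomial E K →ₐ[K] B) = MvPolynomial.aeval (fun i => Sum.elim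
      (fun j => algebraMap (MvPolynomial E' K) B (MvPolynomial.X j))
      (fun j => ψ (MvPolynomial.X j)) (σ.symm i)) := by
    ext i
    obtain ⟨j | j, rfl⟩ := σ.surjective i
    · simpa [gluingEquiv] using
        ψ.commutes (MvPolynomial.X j)
    · simp [gluingEquiv]
  exact DFunLike.congr_fun this p

end Graph

/-! ## The two gadgets -/

namespace Graph

instance : Fintype CutIndex.{u} := ⟨⟨{.left, .right}, by simp⟩, by rintro (_ | _) <;> simp⟩

instance : DecidableEq CutIndex.{u}
  | .left, .left => isTrue rfl
  | .left, .right => isFalse (by simp)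
  | .right, .left => isFalse (by simp)
  | .right, .right => isTrue rfl

/-- The edges of the crossing gadget, numbered. -/
def CrossingEdge.equivFin : CrossingEdge.{u} ≃ Fin 6 where
  toFun
    | .ap => 0
    | .bq => 1
    | .pq₁ => 2
    | .pq₂ => 3
    | .pp' => 4
    | .qq' => 5
  invFun := ![.ap, .bq, .pq₁, .pq₂, .pp', .qq']
  left_inv := by rintro (_ | _ | _ | _ | _ | _) <;> rfl
  right_inv := by decide

instance : DecidableEq CrossingEdge.{u} := CrossingEdge.equivFin.decidableEq

instance : Fintype CrossingEdge.{u} :=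
  ⟨{.ap, .bq, .pq₁, .pq₂, .pp', .qq'}, by rintro (_ | _ | _ | _ | _ | _) <;> decide⟩

section Forms

variable {W : Type v}

/-- The value at the first terminal. -/
abbrev GadgetState.atLeft : GadgetState W →ₗ[ZMod 2] ZMod 2 := LinearMap.fst _ _ _

/-- The value at the second terminal. -/
abbrev GadgetState.atRight : GadgetState W →ₗ[ZMod 2] ZMod 2 :=
  LinearMap.fst _ _ _ ∘ₗ LinearMap.snd _ _ _

/-- The value at an internal vertex. -/
abbrev GadgetState.at (w : W) : GadgetState W →ₗ[ZMod 2] ZMod 2 :=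
  LinearMap.proj w ∘ₗ LinearMap.snd _ _ _ ∘ₗ LinearMap.snd _ _ _

end Forms

/-- The differences along the edges left by cutting an edge. -/
def cutForm : CutIndex.{u} → GadgetState CutIndex.{v} →ₗ[ZMod 2] ZMod 2
  | .left => GadgetState.atLeft - GadgetState.at .left
  | .right => GadgetState.atRight - GadgetState.at .right

theorem isGadgetCut_cutForm (Q : Set CutIndex.{u}) :
    IsGadgetCut cutForm.{u, v} Q ↔ Q = Set.univ := by
  constructor
  · rintro ⟨h, -, -⟩
    -- These states are nonzero at a single new vertex and are detected only by the edge leading to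
    -- it, so both edges must lie in Q.
    have h₁ := h (0, 0, fun | .left => 1 | .right => 0) rfl
    have h₂ := h (0, 0, fun | .left => 0 | .right => 1) rfl
    ext (_ | _)
    · by_contra hl
      have := h₁ (by rintro (_ | _) hi <;> simp_all [cutForm]) .left
      simp [cutForm] at this
    · by_contra hr
      have := h₂ (by rintro (_ | _) hi <;> simp_all [cutForm]) .right
      simp [cutForm] at this
  · rintro rfl
    refine ⟨fun s _ h i => h i trivial,
      ⟨(1, 0, fun | .left => 1 | .right => 0), by simp, ?_⟩, ?_⟩
    · rintro (_ | _) - <;> simp [cutForm]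
    · rintro (_ | _) -
      · refine ⟨(0, 0, fun | .left => 1 | .right => 0), rfl, ?_, by simp [cutForm]⟩
        rintro (_ | _) h <;> simp_all [cutForm]
      · refine ⟨(0, 0, fun | .left => 0 | .right => 1), rfl, ?_, by simp [cutForm]⟩
        rintro (_ | _) h <;> simp_all [cutForm]

/-- Giving each new vertex the value of its terminal yields a state that both edges annihilate and
whose terminals differ. -/
theorem not_isGadgetTree_cutForm (Q : Set CutIndex.{u}) :
    ¬ IsGadgetTree cutForm.{u, v} Q := by
  rintro ⟨h, -⟩
  have := (h (1, 0, fun | .left => 1 | .right => 0)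
    (by rintro (_ | _) - <;> simp [cutForm])).1
  simp at this

/-- The differences along the edges of the crossing gadget. -/
def crossingForm : CrossingEdge.{u} → GadgetState CrossingVertex.{v} →ₗ[ZMod 2] ZMod 2
  | .ap => GadgetState.atLeft - GadgetState.at .p
  | .bq => GadgetState.atRight - GadgetState.at .q
  | .pq₁ => GadgetState.at .p - GadgetState.at .q
  | .pq₂ => GadgetState.at .p - GadgetState.at .q
  | .pp' => GadgetState.at .p - GadgetState.at .p'
  | .qq' => GadgetState.at .q - GadgetState.at .q'

theorem CrossingEdge.forall_iff {P : CrossingEdge.{u} → Prop} :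
    (∀ i, P i) ↔ P .ap ∧ P .bq ∧ P .pq₁ ∧ P .pq₂ ∧ P .pp' ∧ P .qq' :=
  ⟨fun h => ⟨h _, h _, h _, h _, h _, h _⟩, fun ⟨h₁, h₂, h₃, h₄, h₅, h₆⟩ i => by
    cases i <;> assumption⟩

/-- A state of the crossing gadget given by its values. -/
def crossingState (x y p q p' q' : ZMod 2) : GadgetState CrossingVertex.{v} :=
  (x, y, fun | .p => p | .q => q | .p' => p' | .q' => q')

theorem exists_crossingState_eq (s : GadgetState CrossingVertex.{v}) :
    ∃ x y p q p' q', s = crossingState x y p q p' q' := by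
  refine ⟨s.1, s.2.1, s.2.2 .p, s.2.2 .q, s.2.2 .p', s.2.2 .q', ?_⟩
  refine Prod.ext rfl (Prod.ext rfl (funext ?_))
  rintro (_ | _ | _ | _) <;> rfl

/-- Quantifiers over states become quantifiers over six elements of `ZMod 2`, which makes the gadget
conditions decidable by enumeration. -/
theorem exists_crossingState_iff {P : GadgetState CrossingVertex.{v} → Prop} :
    (∃ s, P s) ↔ ∃ x y p q p' q', P (crossingState x y p q p' q') := by
  constructor
  · rintro ⟨s, hs⟩
    obtain ⟨x, y, p, q, p', q', rfl⟩ := exists_crossingState_eq s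
    exact ⟨x, y, p, q, p', q', hs⟩
  · rintro ⟨x, y, p, q, p', q', h⟩
    exact ⟨_, h⟩

theorem forall_crossingState_iff {P : GadgetState CrossingVertex.{v} → Prop} :
    (∀ s, P s) ↔ ∀ x y p q p' q', P (crossingState x y p q p' q') := by
  constructor
  · intro h x y p q p' q'
    exact h _
  · intro h s
    obtain ⟨x, y, p, q, p', q', rfl⟩ := exists_crossingState_eq s
    exact h x y p q p' q'

/-- The conditions on a state imposed by the edges of the crossing gadget, each edge being switched
on or off. -/
def CrossingConditions (c₁ c₂ c₃ c₄ c₅ c₆ : Bool) (x y p q p' q' : ZMod 2) : Prop :=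
  (c₁ → x = p) ∧ (c₂ → y = q) ∧ (c₃ → p = q) ∧ (c₄ → p = q) ∧ (c₅ → p = p') ∧ (c₆ → q = q')

instance (c₁ c₂ c₃ c₄ c₅ c₆ : Bool) (x y p q p' q' : ZMod 2) :
    Decidable (CrossingConditions c₁ c₂ c₃ c₄ c₅ c₆ x y p q p' q') := by
  unfold CrossingConditions; infer_instance

theorem crossingForm_eq_zero_iff (Q : Set CrossingEdge.{u}) (c₁ c₂ c₃ c₄ c₅ c₆ : Bool)
    (h₁ : c₁ ↔ .ap ∈ Q) (h₂ : c₂ ↔ .bq ∈ Q) (h₃ : c₃ ↔ .pq₁ ∈ Q) (h₄ : c₄ ↔ .pq₂ ∈ Q)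
    (h₅ : c₅ ↔ .pp' ∈ Q) (h₆ : c₆ ↔ .qq' ∈ Q) (x y p q p' q' : ZMod 2) :
    (∀ i ∈ Q, crossingForm.{u, v} i (crossingState x y p q p' q') = 0) ↔
      CrossingConditions c₁ c₂ c₃ c₄ c₅ c₆ x y p q p' q' := by
  simp only [CrossingEdge.forall_iff, ← h₁, ← h₂, ← h₃, ← h₄, ← h₅, ← h₆, CrossingConditions,
    crossingForm, crossingState, LinearMap.sub_apply, sub_eq_zero, LinearMap.comp_apply,
    LinearMap.fst_apply, LinearMap.snd_apply, LinearMap.proj_apply]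

set_option synthInstance.maxHeartbeats 200000 in
set_option synthInstance.maxSize 2000 in
set_option maxRecDepth 10000 in
theorem crossingConditions_tree : ∀ c₁ c₂ c₃ c₄ c₅ c₆ : Bool,
    ((∀ x y p q p' q' : ZMod 2, CrossingConditions c₁ c₂ c₃ c₄ c₅ c₆ x y p q p' q' →
      x = y ∧ CrossingConditions true true true true true true x y p q p' q') ∧
    (c₁ → ∃ x y p q p' q' : ZMod 2,
      CrossingConditions false c₂ c₃ c₄ c₅ c₆ x y p q p' q' ∧ x ≠ p) ∧
    (c₂ → ∃ x y p q p' q' : ZMod 2,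
      CrossingConditions c₁ false c₃ c₄ c₅ c₆ x y p q p' q' ∧ y ≠ q) ∧
    (c₃ → ∃ x y p q p' q' : ZMod 2,
      CrossingConditions c₁ c₂ false c₄ c₅ c₆ x y p q p' q' ∧ p ≠ q) ∧
    (c₄ → ∃ x y p q p' q' : ZMod 2,
      CrossingConditions c₁ c₂ c₃ false c₅ c₆ x y p q p' q' ∧ p ≠ q) ∧
    (c₅ → ∃ x y p q p' q' : ZMod 2,
      CrossingConditions c₁ c₂ c₃ c₄ false c₆ x y p q p' q' ∧ p ≠ p') ∧
    (c₆ → ∃ x y p q p' q' : ZMod 2,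
      CrossingConditions c₁ c₂ c₃ c₄ c₅ false x y p q p' q' ∧ q ≠ q')) ↔
    c₁ ∧ c₂ ∧ c₃ ≠ c₄ ∧ c₅ ∧ c₆ := by decide +kernel

set_option synthInstance.maxHeartbeats 200000 in
set_option synthInstance.maxSize 2000 in
set_option maxRecDepth 10000 in
theorem crossingConditions_cut : ∀ c₁ c₂ c₃ c₄ c₅ c₆ : Bool,
    ((∀ x y p q p' q' : ZMod 2, x = y → CrossingConditions c₁ c₂ c₃ c₄ c₅ c₆ x y p q p' q' →
      CrossingConditions true true true true true true x y p q p' q') ∧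
    (∃ x y p q p' q' : ZMod 2, x ≠ y ∧ CrossingConditions c₁ c₂ c₃ c₄ c₅ c₆ x y p q p' q') ∧
    (c₁ → ∃ x y p q p' q' : ZMod 2, x = y ∧
      CrossingConditions false c₂ c₃ c₄ c₅ c₆ x y p q p' q' ∧ x ≠ p) ∧
    (c₂ → ∃ x y p q p' q' : ZMod 2, x = y ∧
      CrossingConditions c₁ false c₃ c₄ c₅ c₆ x y p q p' q' ∧ y ≠ q) ∧
    (c₃ → ∃ x y p q p' q' : ZMod 2, x = y ∧
      CrossingConditions c₁ c₂ false c₄ c₅ c₆ x y p q p' q' ∧ p ≠ q) ∧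
    (c₄ → ∃ x y p q p' q' : ZMod 2, x = y ∧
      CrossingConditions c₁ c₂ c₃ false c₅ c₆ x y p q p' q' ∧ p ≠ q) ∧
    (c₅ → ∃ x y p q p' q' : ZMod 2, x = y ∧
      CrossingConditions c₁ c₂ c₃ c₄ false c₆ x y p q p' q' ∧ p ≠ p') ∧
    (c₆ → ∃ x y p q p' q' : ZMod 2, x = y ∧
      CrossingConditions c₁ c₂ c₃ c₄ c₅ false x y p q p' q' ∧ q ≠ q')) ↔
    (c₁ && c₂ && !c₃ && !c₄ || (c₁ ^^ c₂) && (c₃ ^^ c₄)) && c₅ && c₆ := by decide +kernel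

/-- The spanning trees of the crossing gadget. -/
def crossingTrees : Finset (Finset CrossingEdge.{u}) := {{.pq₁}ᶜ, {.pq₂}ᶜ}

/-- The spanning forests of the crossing gadget that separate the terminals. -/
def crossingCuts : Finset (Finset CrossingEdge.{u}) :=
  {{.pq₁, .pq₂}ᶜ, {.ap, .pq₁}ᶜ, {.ap, .pq₂}ᶜ, {.bq, .pq₁}ᶜ, {.bq, .pq₂}ᶜ}

theorem mem_crossingTrees_iff : ∀ Q : Finset CrossingEdge.{u}, Q ∈ crossingTrees ↔
    .ap ∈ Q ∧ .bq ∈ Q ∧ (decide (.pq₁ ∈ Q)) ≠ (decide (.pq₂ ∈ Q)) ∧ .pp' ∈ Q ∧ .qq' ∈ Q := by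
  decide +kernel

theorem mem_crossingCuts_iff : ∀ Q : Finset CrossingEdge.{u}, Q ∈ crossingCuts ↔
    (decide (.ap ∈ Q) && decide (.bq ∈ Q) && !decide (.pq₁ ∈ Q) && !decide (.pq₂ ∈ Q) ||
      (decide (.ap ∈ Q) ^^ decide (.bq ∈ Q)) && (decide (.pq₁ ∈ Q) ^^ decide (.pq₂ ∈ Q))) &&
      decide (.pp' ∈ Q) && decide (.qq' ∈ Q) := by
  decide +kernel

section

variable (Q : Finset CrossingEdge.{u}) (x y p q p' q' : ZMod 2)

theorem crossingForm_eq_zero_iff_finset :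
    (∀ i ∈ (Q : Set CrossingEdge.{u}), crossingForm.{u, v} i (crossingState x y p q p' q') = 0) ↔
      CrossingConditions (decide (.ap ∈ Q)) (decide (.bq ∈ Q)) (decide (.pq₁ ∈ Q))
        (decide (.pq₂ ∈ Q)) (decide (.pp' ∈ Q)) (decide (.qq' ∈ Q)) x y p q p' q' := by
  apply crossingForm_eq_zero_iff <;> simp

theorem crossingForm_eq_zero_iff_sdiff (i : CrossingEdge.{u}) :
    (∀ j ∈ (Q : Set CrossingEdge.{u}) \ {i},
        crossingForm.{u, v} j (crossingState x y p q p' q') = 0) ↔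
      CrossingConditions (decide (.ap ∈ Q ∧ .ap ≠ i)) (decide (.bq ∈ Q ∧ .bq ≠ i))
        (decide (.pq₁ ∈ Q ∧ .pq₁ ≠ i)) (decide (.pq₂ ∈ Q ∧ .pq₂ ≠ i))
        (decide (.pp' ∈ Q ∧ .pp' ≠ i)) (decide (.qq' ∈ Q ∧ .qq' ≠ i)) x y p q p' q' := by
  apply crossingForm_eq_zero_iff <;> simp

theorem crossingForm_eq_zero_iff_univ :
    (∀ i, crossingForm.{u, v} i (crossingState x y p q p' q') = 0) ↔
      CrossingConditions true true true true true true x y p q p' q' := by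
  rw [← crossingForm_eq_zero_iff.{u, v} (Set.univ : Set CrossingEdge.{u})] <;> simp

theorem isGadgetTree_crossingForm :
    IsGadgetTree crossingForm.{u, v} (Q : Set CrossingEdge.{u}) ↔ Q ∈ crossingTrees := by
  have h := crossingConditions_tree (decide (.ap ∈ Q)) (decide (.bq ∈ Q)) (decide (.pq₁ ∈ Q))
    (decide (.pq₂ ∈ Q)) (decide (.pp' ∈ Q)) (decide (.qq' ∈ Q))
  simp only [decide_eq_true_eq] at h
  rw [mem_crossingTrees_iff, ← h, IsGadgetTree]
  simp only [forall_crossingState_iff, exists_crossingState_iff, crossingForm_eq_zero_iff_finset,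
    crossingForm_eq_zero_iff_sdiff, crossingForm_eq_zero_iff_univ]
  rw [CrossingEdge.forall_iff]
  simp [crossingForm, crossingState, sub_eq_zero]

theorem isGadgetCut_crossingForm :
    IsGadgetCut crossingForm.{u, v} (Q : Set CrossingEdge.{u}) ↔ Q ∈ crossingCuts := by
  have h := crossingConditions_cut (decide (.ap ∈ Q)) (decide (.bq ∈ Q)) (decide (.pq₁ ∈ Q))
    (decide (.pq₂ ∈ Q)) (decide (.pp' ∈ Q)) (decide (.qq' ∈ Q))
  rw [mem_crossingCuts_iff, ← h, IsGadgetCut]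
  simp only [forall_crossingState_iff, exists_crossingState_iff, crossingForm_eq_zero_iff_finset,
    crossingForm_eq_zero_iff_sdiff, crossingForm_eq_zero_iff_univ]
  rw [CrossingEdge.forall_iff]
  simp [crossingForm, crossingState, sub_eq_zero]

end

section Ends

variable {α : Type v}

/-- The ends of the edges left by cutting an edge with ends `a`, `b`. -/
def cutEnds (a b : α) : CutIndex.{u} → Sym2 (α ⊕ CutIndex.{v})
  | .left => s(Sum.inl a, Sum.inr .left)
  | .right => s(Sum.inl b, Sum.inr .right)

/-- The ends of the edges of the crossing gadget attached to `a`, `b`. -/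
def crossingEnds (a b : α) : CrossingEdge.{u} → Sym2 (α ⊕ CrossingVertex.{v})
  | .ap => s(Sum.inl a, Sum.inr .p)
  | .bq => s(Sum.inl b, Sum.inr .q)
  | .pq₁ => s(Sum.inr .p, Sum.inr .q)
  | .pq₂ => s(Sum.inr .p, Sum.inr .q)
  | .pp' => s(Sum.inr .p, Sum.inr .p')
  | .qq' => s(Sum.inr .q, Sum.inr .q')

theorem isGadget_cutForm (a b : α) : IsGadget a b (cutEnds.{u} a b) cutForm.{u, v} := by
  refine ⟨by rintro (_ | _) c <;> simp [cutForm], ?_⟩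
  rintro (_ | _) f p q h <;> simp only [cutEnds, Sym2.eq_iff] at h <;>
    rcases h with ⟨rfl, rfl⟩ | ⟨rfl, rfl⟩ <;>
    refine Iff.trans ?_ sub_eq_zero.symm <;> first | exact Iff.rfl | exact eq_comm

theorem isGadget_crossingForm (a b : α) :
    IsGadget a b (crossingEnds.{u} a b) crossingForm.{u, v} := by
  refine ⟨by rintro (_ | _ | _ | _ | _ | _) c <;> simp [crossingForm], ?_⟩
  rintro (_ | _ | _ | _ | _ | _) f p q h <;> simp only [crossingEnds, Sym2.eq_iff] at h <;>
    rcases h with ⟨rfl, rfl⟩ | ⟨rfl, rfl⟩ <;>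
    refine Iff.trans ?_ sub_eq_zero.symm <;> first | exact Iff.rfl | exact eq_comm

end Ends

/-! ### The coefficients c and d for the two gadgets -/

section Sums

variable {B : Type*} [CommRing B]

open scoped Classical in
theorem sum_cutForm_cut (w : CutIndex.{u} → B) :
    (∑ Q : Finset CutIndex.{u}, if IsGadgetCut cutForm.{u, v} (Q : Set CutIndex.{u}) then
      ∏ i ∈ Qᶜ, w i else 0) = 1 := by
  simp [isGadgetCut_cutForm]

open scoped Classical in
theorem sum_cutForm_tree (w : CutIndex.{u} → B) :
    (∑ Q : Finset CutIndex.{u}, if IsGadgetTree cutForm.{u, v} (Q : Set CutIndex.{u}) then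
      ∏ i ∈ Qᶜ, w i else 0) = 0 := by
  simp [not_isGadgetTree_cutForm]

open scoped Classical in
theorem sum_crossingForm_cut (w : CrossingEdge.{u} → B) :
    (∑ Q : Finset CrossingEdge.{u},
      if IsGadgetCut crossingForm.{u, v} (Q : Set CrossingEdge.{u}) then ∏ i ∈ Qᶜ, w i else 0) =
      w .pq₁ * w .pq₂ + (w .ap + w .bq) * (w .pq₁ + w .pq₂) := by
  simp only [isGadgetCut_crossingForm, Finset.sum_ite_mem, Finset.univ_inter, crossingCuts]
  rw [Finset.sum_insert (by decide), Finset.sum_insert (by decide), Finset.sum_insert (by decide),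
    Finset.sum_insert (by decide), Finset.sum_singleton]
  -- The forests are listed by their complements, so each monomial is the product over a listed
  -- pair.
  simp only [compl_compl]
  rw [Finset.prod_pair (by decide), Finset.prod_pair (by decide), Finset.prod_pair (by decide),
    Finset.prod_pair (by decide), Finset.prod_pair (by decide)]
  ring

open scoped Classical in
theorem sum_crossingForm_tree (w : CrossingEdge.{u} → B) :
    (∑ Q : Finset CrossingEdge.{u},
      if IsGadgetTree crossingForm.{u, v} (Q : Set CrossingEdge.{u}) then ∏ i ∈ Qᶜ, w i else 0) =
      w .pq₁ + w .pq₂ := by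
  simp only [isGadgetTree_crossingForm, Finset.sum_ite_mem, Finset.univ_inter, crossingTrees]
  rw [Finset.sum_pair (by decide)]
  simp

end Sums

end Graph

/-! ## Classes of the three graphs -/

namespace Graph

open Polynomial

/-! ### Linear coordinates adapted to the crossing -/

section Coordinates

open MvPolynomial (finSuccEquiv isEmptyAlgEquiv)

/-- Polynomials in three variables. -/
noncomputable def threeCoordinates (A : Type*) [CommRing A] :
    MvPolynomial (Fin 3) A ≃ₐ[A] A[X][X][X] :=
  (finSuccEquiv A 2).trans (mapAlgEquiv ((finSuccEquiv A 1).trans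
    (mapAlgEquiv ((finSuccEquiv A 0).trans (mapAlgEquiv (isEmptyAlgEquiv A (Fin 0)))))))

section

variable (A : Type*) [CommRing A]

theorem threeCoordinates_C (p : A) : threeCoordinates A (MvPolynomial.C p) = C (C (C p)) :=
  (threeCoordinates A).commutes p

theorem threeCoordinates_X_zero : threeCoordinates A (MvPolynomial.X 0) = X := by
  simp [threeCoordinates, MvPolynomial.finSuccEquiv_X_zero]

theorem threeCoordinates_X_one : threeCoordinates A (MvPolynomial.X 1) = C X := by
  have h : finSuccEquiv A 2 (MvPolynomial.X 1) = C (MvPolynomial.X 0) :=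
    MvPolynomial.finSuccEquiv_X_succ (j := 0)
  simp [threeCoordinates, h, MvPolynomial.finSuccEquiv_X_zero]

theorem threeCoordinates_X_two : threeCoordinates A (MvPolynomial.X 2) = C (C X) := by
  have h : finSuccEquiv A 2 (MvPolynomial.X 2) = C (MvPolynomial.X 1) :=
    MvPolynomial.finSuccEquiv_X_succ (j := 1)
  have h' : finSuccEquiv A 1 (MvPolynomial.X 1) = C (MvPolynomial.X 0) :=
    MvPolynomial.finSuccEquiv_X_succ (j := 0)
  simp [threeCoordinates, h, h', MvPolynomial.finSuccEquiv_X_zero]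

/-- The values of the variables of the crossing gadget in coordinates that are adapted to its
Kirchhoff polynomial. -/
noncomputable def crossingValue : CrossingEdge.{u} → MvPolynomial (Fin 3 ⊕ Fin 3) A
  -- The `inr` coordinates are u = ap + bq + pq₁, t = pq₁ and s = pq₁ + pq₂, in which the
  -- coefficient of F is us - t². The `inl` coordinates bq, pp', qq' are free.
  | .ap => .X (.inr 0) - .X (.inr 1) - .X (.inl 0)
  | .bq => .X (.inl 0)
  | .pq₁ => .X (.inr 1)
  | .pq₂ => .X (.inr 2) - .X (.inr 1)
  | .pp' => .X (.inl 1)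
  | .qq' => .X (.inl 2)

/-- A linear change of coordinates on the space of edge variables of the crossing gadget. -/
noncomputable def crossingCoordinates :
    MvPolynomial CrossingEdge.{u} A ≃ₐ[A] MvPolynomial (Fin 3) (MvPolynomial (Fin 3) A) :=
  (AlgEquiv.ofAlgHom (MvPolynomial.aeval (crossingValue A))
    (MvPolynomial.aeval (Sum.elim ![.X .bq, .X .pp', .X .qq']
      ![.X .ap + .X .bq + .X .pq₁, .X .pq₁, .X .pq₁ + .X .pq₂]))
    (by
      refine MvPolynomial.algHom_ext ?_
      rintro (i | i) <;> fin_cases i <;> simp [crossingValue])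
    (by
      refine MvPolynomial.algHom_ext ?_
      rintro (_ | _ | _ | _ | _ | _) <;> simp [crossingValue])).trans
    (MvPolynomial.sumAlgEquiv A (Fin 3) (Fin 3))

theorem crossingCoordinates_X (i : CrossingEdge.{u}) : crossingCoordinates A (.X i) =
    MvPolynomial.sumAlgEquiv A (Fin 3) (Fin 3) (crossingValue A i) := by
  simp [crossingCoordinates]

end

variable {K : Type u} [Field K] {A : Type u} [CommRing A] [Algebra K A] [Algebra.FiniteType K A]

theorem locClass_mvPolynomial_C_fin (n : ℕ) (f : A) :
    locClass K (MvPolynomial.C f : MvPolynomial (Fin n) A) =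
      (torusClass K + 1) ^ n * locClass K f := by
  induction n with
  | zero =>
    rw [locClass_congr ((isEmptyAlgEquiv A (Fin 0)).restrictScalars K)]
    rw [show (isEmptyAlgEquiv A (Fin 0)).restrictScalars K (MvPolynomial.C f) = f from
      (isEmptyAlgEquiv A (Fin 0)).commutes f, pow_zero, one_mul]
  | succ n ih =>
    rw [locClass_congr ((finSuccEquiv A n).restrictScalars K)]
    have : (finSuccEquiv A n).restrictScalars K (MvPolynomial.C f) = C (MvPolynomial.C f) :=
      (finSuccEquiv A n).commutes f
    rw [this, locClass_C, ih]
    ring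

theorem locClass_mvPolynomial_C {ι : Type u} [Fintype ι] (f : A) :
    locClass K (MvPolynomial.C f : MvPolynomial ι A) =
      (torusClass K + 1) ^ Fintype.card ι * locClass K f := by
  rw [← locClass_mvPolynomial_C_fin,
    locClass_congr ((MvPolynomial.renameEquiv A (Fintype.equivFin ι)).restrictScalars K)]
  exact congrArg _ ((MvPolynomial.renameEquiv A (Fintype.equivFin ι)).commutes f)

/-- `locClass_crossing` in terms of multivariate polynomials. -/
theorem locClass_mvPolynomial_crossing (F H : A) :
    locClass K (.X 2 * (.X 0 * .C F + .C H) - .X 1 ^ 2 * .C F : MvPolynomial (Fin 3) A) =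
      (torusClass K + 1) * torusClass K * (locClass K (X * C F + C H : A[X]) + locClass K F) := by
  rw [← locClass_crossing,
    locClass_congr (B := A[X][X][X]) ((threeCoordinates A).restrictScalars K)]
  change locClass K (threeCoordinates A _) = _
  simp only [map_sub, map_mul, map_add, map_pow, threeCoordinates_X_zero, threeCoordinates_X_one,
    threeCoordinates_X_two, threeCoordinates_C]

end Coordinates

variable {K : Type u} [Field K] {α : Type v} {β : Type u} (G : Graph α β) [Finite E(G)]
  {e : β} {a b : α} [Fintype ↥(E(G) \ {e})]

theorem aeval_algebraMap_X {σ B : Type*} [CommRing B] [Algebra K B]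
    [Algebra (MvPolynomial σ K) B] [IsScalarTower K (MvPolynomial σ K) B] (p : MvPolynomial σ K) :
    MvPolynomial.aeval (fun i => algebraMap (MvPolynomial σ K) B (MvPolynomial.X i)) p =
      algebraMap (MvPolynomial σ K) B p := by
  have := MvPolynomial.aeval_algebraMap_apply (R := K) B (MvPolynomial.X (R := K) (σ := σ)) p
  rw [MvPolynomial.aeval_X_left_apply] at this
  exact this

/-- Deletion and contraction of e, with t_e as the polynomial variable over the ring of the other
edge variables. -/
theorem grothendieckClass_eq (he : G.IsLink e a b) :
    G.grothendieckClass K = locClass K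
      (X * C (G.deletionPolynomial K e) + C (G.contractionPolynomial K e)) := by
  rw [grothendieckClass, KVariety.motivicClass_hypersurfaceComplement,
    locClass_congr (gluingEquiv (edgeSplit he.edge_mem)
      (MvPolynomial.uniqueAlgEquiv (MvPolynomial ↥(E(G) \ {e}) K) PUnit.{u + 1})),
    gluingEquiv_apply, aeval_kirchhoffPolynomial_edgeSplit he.edge_mem]
  have h : (edgeSplit he.edge_mem).symm ⟨e, he.edge_mem⟩ = Sum.inr PUnit.unit :=
    (Equiv.symm_apply_eq _).2 rfl
  simp only [Equiv.symm_apply_apply, Sum.elim_inl, aeval_algebraMap_X, h, Sum.elim_inr]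
  simp

/-- Both pendant edges lie in every spanning forest, so their variables are free and only F remains.
-/
theorem grothendieckClass_cutEdge (he : G.IsLink e a b) (hbridge : ¬ G.IsBridgeEdge e) :
    (G.cutEdge he).grothendieckClass K =
      (torusClass K + 1) ^ 2 * locClass K (G.deletionPolynomial K e) := by
  have hends : ∀ i x, Sum.inl x ∈ cutEnds.{u, v} a b i → x ∈ V(G) := by
    rintro (_ | _) x hx <;> simp [cutEnds] at hx <;> subst hx
    exacts [he.left_mem, he.right_mem]
  have : Finite E(G.replaceEdge e (cutEnds.{u, v} a b) hends) := inferInstance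
  have hclass : (G.cutEdge he).grothendieckClass K =
      (G.replaceEdge e (cutEnds.{u, v} a b) hends).grothendieckClass K := rfl
  rw [hclass, grothendieckClass, KVariety.motivicClass_hypersurfaceComplement,
    locClass_congr (gluingEquiv (replaceEdgeSplit G e _ hends)
      AlgEquiv.refl),
    gluingEquiv_apply, (isGadget_cutForm a b).aeval_kirchhoffPolynomial he hbridge]
  simp only [sum_cutForm_cut, sum_cutForm_tree, one_mul, zero_mul, add_zero,
    Equiv.symm_apply_apply, Sum.elim_inl, aeval_algebraMap_X]
  rw [MvPolynomial.algebraMap_eq, locClass_mvPolynomial_C]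
  rfl

theorem grothendieckClass_crossEdge (he : G.IsLink e a b) (hbridge : ¬ G.IsBridgeEdge e) :
    (G.crossEdge he).grothendieckClass K =
      torusClass K * (torusClass K + 1) ^ 4 * (G.grothendieckClass K +
        locClass K (G.deletionPolynomial K e)) := by
  have hends : ∀ i x, Sum.inl x ∈ crossingEnds.{u, v} a b i → x ∈ V(G) := by
    rintro (_ | _ | _ | _ | _ | _) x hx <;> simp [crossingEnds] at hx <;> subst hx
    exacts [he.left_mem, he.right_mem]
  have : Finite E(G.replaceEdge e (crossingEnds.{u, v} a b) hends) := inferInstance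
  have hclass : (G.crossEdge he).grothendieckClass K =
      (G.replaceEdge e (crossingEnds.{u, v} a b) hends).grothendieckClass K := rfl
  rw [hclass, grothendieckClass, KVariety.motivicClass_hypersurfaceComplement,
    locClass_congr (gluingEquiv (replaceEdgeSplit G e _ hends)
      (crossingCoordinates (MvPolynomial ↥(E(G) \ {e}) K))),
    gluingEquiv_apply, (isGadget_crossingForm a b).aeval_kirchhoffPolynomial he hbridge]
  simp only [sum_crossingForm_cut, sum_crossingForm_tree,
    Equiv.symm_apply_apply, Sum.elim_inl, Sum.elim_inr, aeval_algebraMap_X]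
  have hC : ∀ p, algebraMap (MvPolynomial ↥(E(G) \ {e}) K)
      (MvPolynomial (Fin 3) (MvPolynomial (Fin 3) (MvPolynomial ↥(E(G) \ {e}) K))) p =
        .C (.C p) := fun _ => rfl
  simp only [crossingCoordinates_X, hC, crossingValue, map_sub, MvPolynomial.sumAlgEquiv_X_inl,
    MvPolynomial.sumAlgEquiv_X_inr]
  have key := locClass_mvPolynomial_crossing (K := K) (G.deletionPolynomial K e)
    (G.contractionPolynomial K e)
  rw [grothendieckClass_eq G he]
  -- In the adapted coordinates the Kirchhoff polynomial is constant in the three outer variables,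
  -- which gives 𝕃³; `locClass_mvPolynomial_crossing` handles the inner three.
  refine Eq.trans (congrArg (locClass K) (a₂ := MvPolynomial.C
    (.X 2 * (.X 0 * .C (G.deletionPolynomial K e) + .C (G.contractionPolynomial K e)) -
      .X 1 ^ 2 * .C (G.deletionPolynomial K e))) ?_) ?_
  · simp only [map_sub, map_add, map_mul, map_pow]
    ring
  · rw [locClass_mvPolynomial_C_fin, key]
    ring

end Graph

theorem mainTheorem9 {K : Type u} [Field K] {α : Type v} {β : Type u}
    (Γv : Graph α β) [Finite (Graph.edgeSet Γv)] {e : β} {a b : α} (he : Γv.IsLink e a b)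
    (hbridge : ¬ Γv.IsBridgeEdge e) :
    torusClass K * (torusClass K + 1) ^ 4 * Γv.grothendieckClass K =
        (Γv.crossEdge he).grothendieckClass K -
          torusClass K * (torusClass K + 1) ^ 2 * (Γv.cutEdge he).grothendieckClass K ∧
      algebraMap (GrothendieckRing K)
          (Localization.Away (torusClass K * (torusClass K + 1) ^ 4)) (Γv.grothendieckClass K) =
        Localization.mk
          ((Γv.crossEdge he).grothendieckClass K -
            torusClass K * (torusClass K + 1) ^ 2 * (Γv.cutEdge he).grothendieckClass K)
          ⟨torusClass K * (torusClass K + 1) ^ 4, Submonoid.mem_powers _⟩ := by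
  have := Fintype.ofFinite ↥(Γv.edgeSet \ {e})
  have h : torusClass K * (torusClass K + 1) ^ 4 * Γv.grothendieckClass K =
      (Γv.crossEdge he).grothendieckClass K -
        torusClass K * (torusClass K + 1) ^ 2 * (Γv.cutEdge he).grothendieckClass K := by
    -- The surplus term 𝕋𝕃⁴[F] of the crossing equals 𝕋𝕃² times the class 𝕃²[F] of the cut graph.
    rw [Γv.grothendieckClass_crossEdge he hbridge, Γv.grothendieckClass_cutEdge he hbridge]
    ring
  refine ⟨h, ?_⟩
  rw [← h, Localization.mk_eq_mk', IsLocalization.eq_mk'_iff_mul_eq, ← map_mul,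
    mul_comm (Γv.grothendieckClass K)]
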